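/- \textbf{Setting.} All fields are planar, and $\mathbb T^2=\mathbb R^2/\mathbb Z^2$. For $n\ge 0$ let $\mathcal Q(2\cdot 5^n)$ be the family of open squares contained in $[0,1]^2$ with side $\frac{1}{2\cdot 5^n}$ and vertices in $\frac{1}{2\cdot 5^n}\mathbb Z^2$, and let $r(Q)$ be the lower left vertex of $Q$. Let $V_1,\dots,V_N\in C^\infty([0,1]^2\times[0,1];\mathbb R^2)$ be divergence free and tangent to $\partial[0,1]^2$, and let $(v_n)_{n\ge0}$ be a quasi-self-similar family of velocity fields built from them, i.e. for every $n$: the field $v_n\in C^\infty([0,1]^2\times[0,1];\mathbb R^2)$ is divergence free; there is a compact set $K_n\subset(0,1)^2$ with $v_n(x,t)=0$ for all $x\notin K_n$, $t\in[0,1]$ (in particular $v_n$ is extended by $0$ to $\mathbb R^2$); and for every $Q\in\mathcal Q(2\cdot5^n)$ there is an index $i(Q)\in\{1,\dots,N\}$ with $$v_n(x,t)=\frac1{2\cdot5^n}V_{i(Q)}\big(2\cdot5^n(x-r(Q)),t\big)\qquad\text{for } x\in Q,\ t\in[0,1].$$ Let $\eta\in C^\infty([0,\infty))$ be non-decreasing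 with $\eta(n)=n$ and $\eta^{(k)}(n)=0$ for all integers $n\ge0$, $k\ge1$, and $\sup_{t\ge0}|\eta^{(k)}(t)|<\infty$ for all $k\ge1$. For $x\in\mathbb R^2$, $t\ge 0$ put $$\tilde v(x,t)=\sum_{n\ge0}\eta'(t)\,\chi_{[n,n+1)}(\eta(t))\,v_n(x,\eta(t)-n).$$ For $n\ge1$ let $\lambda_n=\frac1{100}e^{-n}$, $\tau_n=n^{-3}$, $\nu_n=\lambda_n^2\tau_n5^{-2/\tau_n}$, and let $x_n\in\mathbb R^2$ be such that the cubes $Q_n=(-3\lambda_n,3\lambda_n)^2+x_n$, $n\ge1$, are pairwise disjoint and contained in $(1/4,3/4)^2$. Define $$\tilde v_n(x,t)=\frac{\lambda_n}{\tau_n}\tilde v\Big(\frac{x-x_n}{\lambda_n},\frac t{\tau_n}\Big),\qquad v^m=\sum_{n=1}^m\tilde v_n\quad(m\ge1),\qquad v=\sum_{n\ge1}\tilde v_n,$$ where $v^m$ and $v$, which are supported in $(0,1)^2$, are extended $1$-periodically and so regarded as fields on $\mathbb T^2$. For $t\in[0,1]$ let $$g^m=\partial_tv^m+v^m\cdot\nabla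 v^m-\nu_m\Delta v^m .$$ \textbf{Lemma.} For every $p\in[1,\infty)$ there is a finite constant $C(p)$, independent of $m$, such that for all $m\ge1$ one has $g^m\in C([0,1];W^{1,p}(\mathbb T^2))$ and $$\|g^m\|_{C([0,1];W^{1,p}(\mathbb T^2))}\le C(p).$$ Moreover, the time derivative $\partial_t v$ exists at every point of $\mathbb T^2\times[0,1]$ (one-sided at $t=0,1$), $v(\cdot,t)$ has a locally integrable weak gradient $\nabla v(\cdot,t)$ for every $t\in[0,1]$, and the body force $$g=\partial_tv+v\cdot\nabla v$$ belongs to $C([0,1];W^{1,p}(\mathbb T^2))$ and satisfies $g^m\to g$ in $C([0,1];W^{1,p}(\mathbb T^2))$ as $m\to\infty$, for every $p\in[1,\infty)$. -/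

import Mathlib

open Set Filter Topology MeasureTheory
open scoped ENNReal NNReal ContDiff

namespace ForcedNS

/-- The Euclidean plane. -/
abbrev Plane : Type := EuclideanSpace ℝ (Fin 2)

/-- The closed unit square `[0,1]²`. -/
def closedSquare : Set Plane := {x | ∀ i, x i ∈ Icc (0 : ℝ) 1}

/-- The open unit square `(0,1)²`. -/
def openSquare : Set Plane := {x | ∀ i, x i ∈ Ioo (0 : ℝ) 1}

/-- The divergence of a differentiable planar vector field. -/
noncomputable def divergence (f : Plane → Plane) (x : Plane) : ℝ :=
  ∑ i, fderiv ℝ f x (EuclideanSpace.single i 1) i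

/-! ### Quasi-self-similar velocity fields -/

/-- The lower left vertex `r(Q)` of the square `Q` with index `a` in the grid of mesh
`1 / (2 * 5 ^ n)`. -/
noncomputable def corner (n : ℕ) (a : Fin 2 → Fin (2 * 5 ^ n)) : Plane :=
  WithLp.toLp 2 fun i => ((a i : ℕ) : ℝ) / (2 * 5 ^ n)

/-- The open square of side `1 / (2 * 5 ^ n)` with lower left vertex `corner n a`. As `a` varies
these are all the open grid squares of mesh `1 / (2 * 5 ^ n)` contained in `[0,1]²`. -/
def tile (n : ℕ) (a : Fin 2 → Fin (2 * 5 ^ n)) : Set Plane :=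
  {x | ∀ i, corner n a i < x i ∧ x i < corner n a i + 1 / (2 * 5 ^ n)}

/-- A quasi-self-similar family of velocity fields `v₀, v₁, v₂, …`: each `vₙ` is a smooth,
divergence free field on `[0,1]² × [0,1]`, supported away from the boundary of the square (and
extended by zero to the plane), which on every grid square of mesh `1 / (2 * 5 ^ n)` is a rescaled
copy of one out of finitely many fixed smooth building blocks `V₁, …, V_N`. -/
structure QuasiSelfSimilarVelocity where
  /-- the number of building blocks -/
  N : ℕ
  /-- the building blocks `V_j (x, t)` -/
  block : Fin N → Plane → ℝ → Plane
  block_smooth : ∀ j, ContDiffOn ℝ ∞ (fun q : Plane × ℝ => block j q.1 q.2)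
    (closedSquare ×ˢ Icc (0 : ℝ) 1)
  block_divFree : ∀ j, ∀ t ∈ Icc (0 : ℝ) 1, ∀ x ∈ openSquare,
    divergence (fun y => block j y t) x = 0
  block_tangent : ∀ j, ∀ t ∈ Icc (0 : ℝ) 1, ∀ x ∈ closedSquare, ∀ i,
    (x i = 0 ∨ x i = 1) → block j x t i = 0
  /-- the index `i(Q)` of the building block placed in the square `Q` -/
  idx : ∀ n, (Fin 2 → Fin (2 * 5 ^ n)) → Fin N
  /-- the velocity fields `vₙ (x, t)` -/
  vel : ℕ → Plane → ℝ → Plane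
  vel_smooth : ∀ n, ContDiffOn ℝ ∞ (fun q : Plane × ℝ => vel n q.1 q.2)
    (closedSquare ×ˢ Icc (0 : ℝ) 1)
  vel_divFree : ∀ n, ∀ t ∈ Icc (0 : ℝ) 1, ∀ x ∈ openSquare,
    divergence (fun y => vel n y t) x = 0
  vel_support : ∀ n, ∃ K : Set Plane, IsCompact K ∧ K ⊆ openSquare ∧
    ∀ t ∈ Icc (0 : ℝ) 1, ∀ x, x ∉ K → vel n x t = 0
  vel_tile : ∀ n a, ∀ x ∈ tile n a, ∀ t ∈ Icc (0 : ℝ) 1,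
    vel n x t = (1 / (2 * 5 ^ n) : ℝ) •
      block (idx n a) ((2 * 5 ^ n : ℝ) • (x - corner n a)) t

/-- The admissible time reparametrizations `η : [0,∞) → [0,∞)`: smooth, non-decreasing, equal to
the identity and flat to infinite order at the integers, and with bounded derivatives. -/
structure IsTimeReparam (η : ℝ → ℝ) : Prop where
  smooth : ContDiffOn ℝ ∞ η (Ici 0)
  mono : MonotoneOn η (Ici 0)
  map_nat : ∀ n : ℕ, η n = n
  flat : ∀ n k : ℕ, 1 ≤ k → iteratedDerivWithin k η (Ici 0) n = 0
  bounded : ∀ k : ℕ, 1 ≤ k → ∃ C : ℝ, ∀ t ∈ Ici (0 : ℝ), |iteratedDerivWithin k η (Ici 0) t| ≤ C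

/-- The field `ṽ (x, t) = ∑ₙ η'(t) χ_{[n,n+1)}(η(t)) vₙ(x, η(t) - n)` for `t ≥ 0`. -/
noncomputable def baseVel (W : QuasiSelfSimilarVelocity) (η : ℝ → ℝ) (x : Plane) (t : ℝ) : Plane :=
  ∑' n : ℕ, (Ico (n : ℝ) (n + 1)).indicator
    (fun s => derivWithin η (Ici 0) t • W.vel n x (s - n)) (η t)

/-! ### Scaling and iteration -/

/-- `λₙ = e⁻ⁿ / 100`. -/
noncomputable def lam (n : ℕ) : ℝ := 1 / 100 * Real.exp (-(n : ℝ))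

/-- `τₙ = 1 / n³`, for `n ≥ 1`. -/
noncomputable def tau (n : ℕ) : ℝ := 1 / (n : ℝ) ^ 3

/-- `νₘ = λₘ² τₘ 5^(-2/τₘ)`, for `m ≥ 1`. -/
noncomputable def nu (m : ℕ) : ℝ := lam m ^ 2 * tau m * (5 : ℝ) ^ (-2 / tau m)

/-- The cube `Qₙ = (-3λₙ, 3λₙ)² + xₙ`. -/
def cube (c : ℕ → Plane) (n : ℕ) : Set Plane :=
  {x | ∀ i, |x i - c n i| < 3 * lam n}

/-- `c n = xₙ`, `n ≥ 1`, are centres for which the cubes `Qₙ` are pairwise disjoint and contained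
in `(1/4, 3/4)²`. -/
structure IsCubeCentres (c : ℕ → Plane) : Prop where
  disjoint : ∀ n k : ℕ, 1 ≤ n → 1 ≤ k → n ≠ k → Disjoint (cube c n) (cube c k)
  inside : ∀ n : ℕ, 1 ≤ n → ∀ x ∈ cube c n, ∀ i, x i ∈ Ioo (1 / 4 : ℝ) (3 / 4)

/-- `ṽₙ (x, t) = (λₙ / τₙ) ṽ ((x - xₙ) / λₙ, t / τₙ)`. -/
noncomputable def scaledVel (W : QuasiSelfSimilarVelocity) (η : ℝ → ℝ) (c : ℕ → Plane)
    (n : ℕ) (x : Plane) (t : ℝ) : Plane :=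
  (lam n / tau n) • baseVel W η ((1 / lam n) • (x - c n)) (t / tau n)

/-- The representative of `x` modulo `ℤ²` in the unit cell `[0,1)²`. -/
noncomputable def fractPt (x : Plane) : Plane := WithLp.toLp 2 fun i => Int.fract (x i)

/-- The `1`-periodic extension of a field that is supported in `(0,1)²`. -/
noncomputable def periodize (f : Plane → ℝ → Plane) (x : Plane) (t : ℝ) : Plane :=
  f (fractPt x) t

/-- The velocity `v = ∑_{n ≥ 1} ṽₙ`, extended periodically. -/
noncomputable def limitVel (W : QuasiSelfSimilarVelocity) (η : ℝ → ℝ) (c : ℕ → Plane) :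
    Plane → ℝ → Plane :=
  periodize fun x t => ∑' n : ℕ, scaledVel W η c (n + 1) x t

/-- The velocity `vᵐ = ∑_{n=1}^m ṽₙ`, extended periodically. -/
noncomputable def truncVel (W : QuasiSelfSimilarVelocity) (η : ℝ → ℝ) (c : ℕ → Plane) (m : ℕ) :
    Plane → ℝ → Plane :=
  periodize fun x t => ∑ n ∈ Finset.Icc 1 m, scaledVel W η c n x t

/-- The body force `∂ₜ w + w · ∇ w - ν Δ w` on the time interval `[0,1]` generated by a smooth
velocity field `w`. -/
noncomputable def nsForce (ν : ℝ) (w : Plane → ℝ → Plane) (x : Plane) (t : ℝ) : Plane :=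
  derivWithin (fun s => w x s) (Icc 0 1) t + fderiv ℝ (fun y => w y t) x (w x t)
    - ν • Laplacian.laplacian (fun y => w y t) x

/-- The body force `gᵐ = ∂ₜ vᵐ + vᵐ · ∇ vᵐ - νₘ Δ vᵐ`. -/
noncomputable def force (W : QuasiSelfSimilarVelocity) (η : ℝ → ℝ) (c : ℕ → Plane) (m : ℕ) :
    Plane → ℝ → Plane :=
  nsForce (nu m) (truncVel W η c m)

/-! ### Sobolev spaces on the torus, as spaces of periodic fields on the plane -/

/-- `1`-periodicity in both variables. -/
def IsPeriodic (f : Plane → Plane) : Prop :=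
  ∀ (x : Plane) (k : Fin 2 → ℤ), f (x + WithLp.toLp 2 fun i => (k i : ℝ)) = f x

/-- The unit cell `[0,1)²`, a fundamental domain of the torus. -/
def unitCell : Set Plane := {x | ∀ i, x i ∈ Ico (0 : ℝ) 1}

/-- `G` is the distributional gradient of `f`. -/
structure IsWeakGradient (f : Plane → Plane) (G : Plane → Plane →L[ℝ] Plane) : Prop where
  locInt : LocallyIntegrable f volume
  locInt_grad : LocallyIntegrable G volume
  integral_eq : ∀ φ : Plane → ℝ, ContDiff ℝ ∞ φ → HasCompactSupport φ → ∀ e : Plane,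
    ∫ x, φ x • G x e = - ∫ x, fderiv ℝ φ x e • f x

/-- The norm of `W^{1,p}(𝕋²)`, with the value `∞` for periodic fields that do not belong to that
space; the infimum runs over the weak gradients of `f`, which agree almost everywhere. -/
noncomputable def w1pNorm (p : ℝ≥0∞) (f : Plane → Plane) : ℝ≥0∞ :=
  ⨅ (G : Plane → Plane →L[ℝ] Plane) (_ : IsWeakGradient f G),
    eLpNorm f p (volume.restrict unitCell) + eLpNorm G p (volume.restrict unitCell)

/-- The norm of `C([0,1]; W^{1,p}(𝕋²))`. -/
noncomputable def cW1pNorm (p : ℝ≥0∞) (f : Plane → ℝ → Plane) : ℝ≥0∞ :=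
  ⨆ t ∈ Icc (0 : ℝ) 1, w1pNorm p fun x => f x t

/-- `f` belongs to `C([0,1]; W^{1,p}(𝕋²))`. -/
structure MemCW1p (p : ℝ≥0∞) (f : Plane → ℝ → Plane) : Prop where
  periodic : ∀ t ∈ Icc (0 : ℝ) 1, IsPeriodic fun x => f x t
  finite : ∀ t ∈ Icc (0 : ℝ) 1, w1pNorm p (fun x => f x t) < ⊤
  continuous : ∀ t ∈ Icc (0 : ℝ) 1,
    Tendsto (fun s => w1pNorm p fun x => f x s - f x t) (𝓝[Icc 0 1] t) (𝓝 0)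

/-- `g = ∂ₜ v + v · ∇ v` on `[0,1]`, where the time derivative exists at every point and `∇ v` is
the weak gradient. -/
def IsEulerForce (v g : Plane → ℝ → Plane) : Prop :=
  ∃ (vt : Plane → ℝ → Plane) (Dv : ℝ → Plane → Plane →L[ℝ] Plane),
    (∀ x, ∀ t ∈ Icc (0 : ℝ) 1, HasDerivWithinAt (fun s => v x s) (vt x t) (Icc 0 1) t) ∧
    (∀ t ∈ Icc (0 : ℝ) 1, IsWeakGradient (fun x => v x t) (Dv t)) ∧
    ∀ t ∈ Icc (0 : ℝ) 1, ∀ x, g x t = vt x t + Dv t x (v x t)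

end ForcedNS

namespace ForcedNS

/-! ### Weak gradients -/

/-! The cubes Q_n are disjoint and do not move, so at each point at most one ṽ_n is ever nonzero.
The quadratic term therefore has no cross terms, and every estimate reduces to a single cube
(`exists_index`, `force_eq`).

On Q_n at time t only the stage k = ⌊t/τ_n⌋ ≤ n³ is active. Put P = 2·5^k. There are finitely many
building blocks, so each spatial derivative of v_k costs one factor P (`IsScaledFamily`). Up to
constants, ṽ_n, Dṽ_n, D²ṽ_n and DΔṽ_n are bounded by λ_n n³/P, n³, n³P/λ_n and n³P²/λ_n², while
∂ₜṽ_n and its gradient are bounded by n⁶. In the gradient of ṽ_n·∇ṽ_n, both P and λ_n cancel from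
the product of D²ṽ_n with ṽ_n, so the Euler force and its gradient are O(n⁶). Since 1/ν_n = n³ λ_n⁻²
25^(n³), the Laplacian and its gradient are O(1/ν_n) (`exists_piece_bound`). The viscous term of g^m
on Q_n, n ≤ m, is then O(ν_m/ν_n): bounded, and vanishing as m → ∞ for fixed n.

The area of Q_n decays like e^(-2n), so the function equal to K n⁶ on Q_n lies in L^p for every p <
∞ (`memLp_dom`). Such majorants, independent of t and m, give the uniform bound directly. Dominated
convergence then gives continuity in time, the weak gradients of the infinite sums and g^m → g.
Regularity in time at fixed x comes from the flatness of η at the integers, which glues consecutive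
stages (`hasDerivWithinAt_glue`). -/

theorem isWeakGradient_of_hasFDerivAt {f : Plane → Plane} {G : Plane → Plane →L[ℝ] Plane}
    (hf : ∀ x, HasFDerivAt f (G x) x) (hG : Continuous G) : IsWeakGradient f G := by
  have hfc : Continuous f := continuous_iff_continuousAt.2 fun x => (hf x).continuousAt
  refine ⟨hfc.locallyIntegrable, hG.locallyIntegrable, fun φ hφ hc e => ?_⟩
  have hφ' : Continuous fun x => fderiv ℝ φ x e :=
    (hφ.continuous_fderiv (by simp)).clm_apply continuous_const
  have hc' : HasCompactSupport fun x => fderiv ℝ φ x e :=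
    hc.fderiv_apply (𝕜 := ℝ) e
  have key := integral_smul_fderiv_eq_neg_fderiv_smul_of_integrable (μ := (volume : Measure Plane))
    (𝕜 := ℝ) (f := φ) (g := f) (v := e) ?_ ?_ ?_ ?_ ?_
  · simpa only [(hf _).fderiv] using key
  · exact (hφ'.smul hfc).integrable_of_hasCompactSupport hc'.smul_right
  · simp only [(hf _).fderiv]
    exact (hφ.continuous.smul (hG.clm_apply continuous_const)).integrable_of_hasCompactSupport
      hc.smul_right
  · exact (hφ.continuous.smul hfc).integrable_of_hasCompactSupport hc.smul_right
  · exact fun x _ => (hφ.differentiable (by simp)).differentiableAt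
  · exact fun x _ => (hf x).differentiableAt

theorem integrable_smul_of_hasCompactSupport {E : Type*} [NormedAddCommGroup E] [NormedSpace ℝ E]
    {φ : Plane → ℝ} (hφ : Continuous φ) (hc : HasCompactSupport φ) {f : Plane → E}
    (hf : LocallyIntegrable f volume) : Integrable (fun x => φ x • f x) volume :=
  hf.integrable_smul_left_of_hasCompactSupport hφ hc

theorem IsWeakGradient.sub {f f' : Plane → Plane} {G G' : Plane → Plane →L[ℝ] Plane}
    (h : IsWeakGradient f G) (h' : IsWeakGradient f' G') :
    IsWeakGradient (fun x => f x - f' x) (fun x => G x - G' x) := by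
  refine ⟨h.locInt.sub h'.locInt, h.locInt_grad.sub h'.locInt_grad, fun φ hφ hc e => ?_⟩
  have hφ' : Continuous fun x => fderiv ℝ φ x e :=
    (hφ.continuous_fderiv (by simp)).clm_apply continuous_const
  have hc' : HasCompactSupport fun x => fderiv ℝ φ x e :=
    hc.fderiv_apply (𝕜 := ℝ) e
  have i1 : ∀ {H : Plane → Plane →L[ℝ] Plane}, LocallyIntegrable H volume →
      Integrable (fun x => φ x • H x e) volume := fun hH => by
    simpa using
        (integrable_smul_of_hasCompactSupport hφ.continuous hc hH).apply_continuousLinearMap e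
  simp only [_root_.sub_apply, smul_sub]
  rw [integral_sub (i1 h.locInt_grad) (i1 h'.locInt_grad),
    integral_sub (integrable_smul_of_hasCompactSupport hφ' hc' h.locInt)
      (integrable_smul_of_hasCompactSupport hφ' hc' h'.locInt),
    h.integral_eq φ hφ hc e, h'.integral_eq φ hφ hc e]
  abel

/-- Weak gradients pass to dominated pointwise limits. -/
theorem IsWeakGradient.of_tendsto {f : ℕ → Plane → Plane} {G : ℕ → Plane → Plane →L[ℝ] Plane}
    {f₀ : Plane → Plane} {G₀ : Plane → Plane →L[ℝ] Plane} {M : Plane → ℝ}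
    (h : ∀ m, IsWeakGradient (f m) (G m)) (hM : LocallyIntegrable M volume)
    (hfM : ∀ m x, ‖f m x‖ ≤ M x) (hGM : ∀ m x, ‖G m x‖ ≤ M x)
    (hf : ∀ x, Tendsto (fun m => f m x) atTop (𝓝 (f₀ x)))
    (hG : ∀ x, Tendsto (fun m => G m x) atTop (𝓝 (G₀ x))) : IsWeakGradient f₀ G₀ := by
  have mf : ∀ m, AEStronglyMeasurable (f m) volume := fun m => (h m).locInt.aestronglyMeasurable
  have mG : ∀ m, AEStronglyMeasurable (G m) volume :=
    fun m => (h m).locInt_grad.aestronglyMeasurable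
  refine ⟨hM.mono (aestronglyMeasurable_of_tendsto_ae atTop mf (ae_of_all _ hf))
      (ae_of_all _ fun x => ?_), hM.mono
      (aestronglyMeasurable_of_tendsto_ae atTop mG (ae_of_all _ hG))
      (ae_of_all _ fun x => ?_), fun φ hφ hc e => ?_⟩
  · exact (le_of_tendsto (hf x).norm (Eventually.of_forall fun m => hfM m x)).trans
      (Real.le_norm_self _)
  · exact (le_of_tendsto (hG x).norm (Eventually.of_forall fun m => hGM m x)).trans
      (Real.le_norm_self _)
  have hφ' : Continuous fun x => fderiv ℝ φ x e :=
    (hφ.continuous_fderiv (by simp)).clm_apply continuous_const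
  have hc' : HasCompactSupport fun x => fderiv ℝ φ x e :=
    hc.fderiv_apply (𝕜 := ℝ) e
  have t1 : Tendsto (fun m => ∫ x, φ x • G m x e) atTop (𝓝 (∫ x, φ x • G₀ x e)) := by
    refine tendsto_integral_of_dominated_convergence (fun x => ‖φ x • M x‖ * ‖e‖) ?_ ?_ ?_ ?_
    · exact fun m => hφ.continuous.aestronglyMeasurable.smul
        ((mG m).apply_continuousLinearMap e)
    · exact (integrable_smul_of_hasCompactSupport hφ.continuous hc hM).norm.mul_const _
    · refine fun m => ae_of_all _ fun x => ?_
      rw [norm_smul, norm_smul, mul_assoc]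
      gcongr
      exact ((G m x).le_opNorm e).trans (by gcongr; exact (hGM m x).trans (Real.le_norm_self _))
    · exact ae_of_all _ fun x => tendsto_const_nhds.smul
        (((ContinuousLinearMap.apply ℝ Plane e).continuous.tendsto _).comp (hG x))
  have t2 : Tendsto (fun m => ∫ x, fderiv ℝ φ x e • f m x) atTop
      (𝓝 (∫ x, fderiv ℝ φ x e • f₀ x)) := by
    refine tendsto_integral_of_dominated_convergence (fun x => ‖fderiv ℝ φ x e • M x‖) ?_ ?_ ?_ ?_
    · exact fun m => hφ'.aestronglyMeasurable.smul (mf m)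
    · exact (integrable_smul_of_hasCompactSupport hφ' hc' hM).norm
    · refine fun m => ae_of_all _ fun x => ?_
      rw [norm_smul, norm_smul]
      gcongr
      exact (hfM m x).trans (Real.le_norm_self _)
    · exact ae_of_all _ fun x => tendsto_const_nhds.smul (hf x)
  refine tendsto_nhds_unique t1 ?_
  simp only [fun m => (h m).integral_eq φ hφ hc e]
  exact t2.neg

/-! ### Dominated convergence in `Lᵖ` and the spaces `C([0,1]; W^{1,p})` -/

/-- A general countably generated filter covers both uses: s → t within [0,1], and m → ∞. -/
theorem tendsto_eLpNorm_of_dominated {ι X E : Type*} {l : Filter ι} [l.IsCountablyGenerated]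
    [MeasurableSpace X] {μ : Measure X} [NormedAddCommGroup E] {F : ι → X → E} {M : X → ℝ}
    {p : ℝ≥0∞} (hp0 : p ≠ 0) (hp : p ≠ ⊤)
    (hF : ∀ᶠ i in l, AEStronglyMeasurable (F i) μ) (hFM : ∀ᶠ i in l, ∀ x, ‖F i x‖ ≤ M x)
    (hM : MemLp M p μ) (hlim : ∀ x, Tendsto (fun i => F i x) l (𝓝 0)) :
    Tendsto (fun i => eLpNorm (F i) p μ) l (𝓝 0) := by
  have hpos : 0 < p.toReal := ENNReal.toReal_pos hp0 hp
  simp only [eLpNorm_eq_lintegral_rpow_enorm_toReal hp0 hp]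
  have key : Tendsto (fun i => ∫⁻ x, ‖F i x‖ₑ ^ p.toReal ∂μ) l (𝓝 (∫⁻ _, 0 ∂μ)) := by
    refine tendsto_lintegral_filter_of_dominated_convergence' (fun x => ‖M x‖ₑ ^ p.toReal)
      ?_ ?_ ?_ ?_
    · filter_upwards [hF] with i hi using hi.enorm.pow_const _
    · filter_upwards [hFM] with i hi
      refine ae_of_all _ fun x => ?_
      gcongr
      rw [enorm_le_iff_norm_le]
      exact (hi x).trans (Real.le_norm_self _)
    · exact (lintegral_rpow_enorm_lt_top_of_eLpNorm_lt_top hp0 hp hM.2).ne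
    · refine ae_of_all _ fun x => ?_
      have h1 : Tendsto (fun i => ‖F i x‖ₑ) l (𝓝 0) := by
        simpa using (hlim x).enorm
      have := (ENNReal.continuous_rpow_const (y := p.toReal)).tendsto 0 |>.comp h1
      simpa [hpos, Function.comp_def] using this
  have := (ENNReal.continuous_rpow_const (y := 1 / p.toReal)).tendsto _ |>.comp key
  simpa [hpos, Function.comp_def] using this

theorem w1pNorm_le {p : ℝ≥0∞} {f : Plane → Plane} {G : Plane → Plane →L[ℝ] Plane}
    (h : IsWeakGradient f G) : w1pNorm p f ≤
      eLpNorm f p (volume.restrict unitCell) + eLpNorm G p (volume.restrict unitCell) :=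
  iInf₂_le G h

theorem w1pNorm_le_of_bound {p : ℝ≥0∞} {f : Plane → Plane} {G : Plane → Plane →L[ℝ] Plane}
    {M : Plane → ℝ} (h : IsWeakGradient f G) (hf : ∀ x, ‖f x‖ ≤ M x) (hG : ∀ x, ‖G x‖ ≤ M x) :
    w1pNorm p f ≤ 2 * eLpNorm M p (volume.restrict unitCell) := by
  rw [two_mul]
  exact (w1pNorm_le h).trans (add_le_add
    (eLpNorm_mono fun x => (hf x).trans (Real.le_norm_self _))
    (eLpNorm_mono fun x => (hG x).trans (Real.le_norm_self _)))

theorem cW1pNorm_le_of_bound {p : ℝ≥0∞} {f : Plane → ℝ → Plane}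
    {G : Plane → ℝ → Plane →L[ℝ] Plane} {M : Plane → ℝ}
    (h : ∀ t ∈ Icc (0 : ℝ) 1, IsWeakGradient (fun x => f x t) (fun x => G x t))
    (hf : ∀ t ∈ Icc (0 : ℝ) 1, ∀ x, ‖f x t‖ ≤ M x)
    (hG : ∀ t ∈ Icc (0 : ℝ) 1, ∀ x, ‖G x t‖ ≤ M x) :
    cW1pNorm p f ≤ 2 * eLpNorm M p (volume.restrict unitCell) :=
  iSup₂_le fun t ht => w1pNorm_le_of_bound (h t ht) (hf t ht) (hG t ht)

/-- Continuity in time at each fixed x is enough: a time-independent majorant in L^p upgrades it to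
continuity in W^{1,p} by dominated convergence, the differences being at most 2M. -/
theorem memCW1p_of_bound {p : ℝ≥0∞} (hp0 : p ≠ 0) (hp : p ≠ ⊤) {f : Plane → ℝ → Plane}
    {G : Plane → ℝ → Plane →L[ℝ] Plane} {M : Plane → ℝ}
    (hper : ∀ t ∈ Icc (0 : ℝ) 1, IsPeriodic fun x => f x t)
    (h : ∀ t ∈ Icc (0 : ℝ) 1, IsWeakGradient (fun x => f x t) (fun x => G x t))
    (hf : ∀ t ∈ Icc (0 : ℝ) 1, ∀ x, ‖f x t‖ ≤ M x)
    (hG : ∀ t ∈ Icc (0 : ℝ) 1, ∀ x, ‖G x t‖ ≤ M x)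
    (hfc : ∀ x, ContinuousOn (f x) (Icc 0 1)) (hGc : ∀ x, ContinuousOn (G x) (Icc 0 1))
    (hM : MemLp M p (volume.restrict unitCell)) : MemCW1p p f := by
  refine ⟨hper, fun t ht => (w1pNorm_le_of_bound (h t ht) (hf t ht) (hG t ht)).trans_lt
    (ENNReal.mul_lt_top (by simp) hM.2), fun t ht => ?_⟩
  have hM2 : MemLp (fun x => M x + M x) p (volume.restrict unitCell) := hM.add hM
  have aux : ∀ {E : Type} [NormedAddCommGroup E] (F : Plane → ℝ → E),
      (∀ t ∈ Icc (0 : ℝ) 1, AEStronglyMeasurable (fun x => F x t) (volume : Measure Plane)) →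
      (∀ t ∈ Icc (0 : ℝ) 1, ∀ x, ‖F x t‖ ≤ M x) → (∀ x, ContinuousOn (F x) (Icc 0 1)) →
      Tendsto (fun s => eLpNorm (fun x => F x s - F x t) p (volume.restrict unitCell))
        (𝓝[Icc 0 1] t) (𝓝 0) := by
    intro E _ F hm hF hFc
    refine tendsto_eLpNorm_of_dominated hp0 hp ?_ ?_ hM2 fun x => ?_
    · filter_upwards [self_mem_nhdsWithin] with s hs
      exact ((hm s hs).sub (hm t ht)).restrict
    · filter_upwards [self_mem_nhdsWithin] with s hs x
      exact (norm_sub_le _ _).trans (add_le_add (hF s hs x) (hF t ht x))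
    · exact tendsto_sub_nhds_zero_iff.2 (hFc x t ht)
  have t1 := aux f (fun t ht => (h t ht).locInt.aestronglyMeasurable) hf hfc
  have t2 := aux G (fun t ht => (h t ht).locInt_grad.aestronglyMeasurable) hG hGc
  have t3 := t1.add t2
  rw [add_zero] at t3
  refine tendsto_of_tendsto_of_tendsto_of_le_of_le' tendsto_const_nhds t3
    (Eventually.of_forall fun _ => zero_le) ?_
  filter_upwards [self_mem_nhdsWithin] with s hs
  exact w1pNorm_le ((h s hs).sub (h t ht))

/-! ### Partial derivatives on space-time slabs -/

section Partial

variable {E : Type*} [NormedAddCommGroup E] [NormedSpace ℝ E]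

/-- The space-time slab over a set `X` of the plane. -/
def slab (X : Set Plane) : Set (Plane × ℝ) := X ×ˢ Icc (0 : ℝ) 1

/-- The spatial derivative of a function on a slab. -/
noncomputable def dX (X : Set Plane) (u : Plane × ℝ → E) (q : Plane × ℝ) : Plane →L[ℝ] E :=
  (fderivWithin ℝ u (slab X) q).comp (ContinuousLinearMap.inl ℝ Plane ℝ)

/-- The time derivative of a function on a slab. -/
noncomputable def dT (X : Set Plane) (u : Plane × ℝ → E) (q : Plane × ℝ) : E :=
  fderivWithin ℝ u (slab X) q (0, 1)

theorem uniqueDiffOn_slab {X : Set Plane} (hX : UniqueDiffOn ℝ X) : UniqueDiffOn ℝ (slab X) :=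
  hX.prod (uniqueDiffOn_Icc zero_lt_one)

theorem contDiffOn_dX {X : Set Plane} (hX : UniqueDiffOn ℝ X) {u : Plane × ℝ → E}
    (hu : ContDiffOn ℝ ∞ u (slab X)) : ContDiffOn ℝ ∞ (dX X u) (slab X) :=
  (hu.fderivWithin (uniqueDiffOn_slab hX) (by simp)).clm_comp contDiffOn_const

theorem contDiffOn_dT {X : Set Plane} (hX : UniqueDiffOn ℝ X) {u : Plane × ℝ → E}
    (hu : ContDiffOn ℝ ∞ u (slab X)) : ContDiffOn ℝ ∞ (dT X u) (slab X) :=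
  (hu.fderivWithin (uniqueDiffOn_slab hX) (by simp)).clm_apply contDiffOn_const

theorem hasFDerivWithinAt_dX {X : Set Plane} {u : Plane × ℝ → E}
    (hu : ContDiffOn ℝ ∞ u (slab X)) {x : Plane} {t : ℝ} (hx : x ∈ X) (ht : t ∈ Icc (0 : ℝ) 1) :
    HasFDerivWithinAt (fun y => u (y, t)) (dX X u (x, t)) X x := by
  have h1 : HasFDerivWithinAt u (fderivWithin ℝ u (slab X) (x, t)) (slab X) (x, t) :=
    (hu.differentiableOn (by simp) (x, t) ⟨hx, ht⟩).hasFDerivWithinAt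
  have h2 : HasFDerivWithinAt (fun y : Plane => (y, t)) (ContinuousLinearMap.inl ℝ Plane ℝ) X x :=
    (hasFDerivAt_prodMk_left x t).hasFDerivWithinAt
  have h3 : MapsTo (fun y : Plane => (y, t)) X (slab X) := fun y hy => ⟨hy, ht⟩
  exact h1.comp x h2 h3

theorem hasDerivWithinAt_dT {X : Set Plane} {u : Plane × ℝ → E}
    (hu : ContDiffOn ℝ ∞ u (slab X)) {x : Plane} {t : ℝ} (hx : x ∈ X) (ht : t ∈ Icc (0 : ℝ) 1) :
    HasDerivWithinAt (fun s => u (x, s)) (dT X u (x, t)) (Icc 0 1) t := by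
  have h1 : HasFDerivWithinAt u (fderivWithin ℝ u (slab X) (x, t)) (slab X) (x, t) :=
    (hu.differentiableOn (by simp) (x, t) ⟨hx, ht⟩).hasFDerivWithinAt
  have h2 : HasFDerivWithinAt (fun s : ℝ => (x, s)) (ContinuousLinearMap.inr ℝ Plane ℝ)
      (Icc 0 1) t := (hasFDerivAt_prodMk_right x t).hasFDerivWithinAt
  have h3 := (h1.comp t h2 fun y hy => ⟨hx, hy⟩).hasDerivWithinAt
  simpa [dT, Function.comp_def] using h3

end Partial

/-! ### The geometry of the grid -/

theorem continuous_coord (i : Fin 2) : Continuous fun x : Plane => x i :=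
  (EuclideanSpace.proj (𝕜 := ℝ) i).continuous

theorem isOpen_openSquare : IsOpen openSquare := by
  have : openSquare = ⋂ i, {x : Plane | x i ∈ Ioo (0 : ℝ) 1} := by ext; simp [openSquare]
  rw [this]
  exact isOpen_iInter_of_finite fun i => isOpen_Ioo.preimage (continuous_coord i)

theorem openSquare_subset : openSquare ⊆ closedSquare := fun _ hx i => Ioo_subset_Icc_self (hx i)

theorem isOpen_tile (n : ℕ) (a : Fin 2 → Fin (2 * 5 ^ n)) : IsOpen (tile n a) := by
  have : tile n a = ⋂ i, {x : Plane | x i ∈ Ioo (corner n a i) (corner n a i + 1 / (2 * 5 ^ n))} := by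
    ext; simp [tile]
  rw [this]
  exact isOpen_iInter_of_finite fun i => isOpen_Ioo.preimage (continuous_coord i)

theorem isCompact_closedSquare : IsCompact closedSquare := by
  refine Metric.isCompact_of_isClosed_isBounded ?_ ?_
  · have : closedSquare = ⋂ i, {x : Plane | x i ∈ Icc (0 : ℝ) 1} := by ext; simp [closedSquare]
    rw [this]
    exact isClosed_iInter fun i => isClosed_Icc.preimage (continuous_coord i)
  · refine (Metric.isBounded_closedBall (x := (0 : Plane)) (r := 2)).subset fun x hx => ?_
    rw [mem_closedBall_zero_iff, EuclideanSpace.norm_eq]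
    refine Real.sqrt_le_iff.2 ⟨by norm_num, ?_⟩
    have h0 := hx 0
    have h1 := hx 1
    simp only [Fin.sum_univ_two, Real.norm_eq_abs, sq_abs]
    nlinarith [h0.1, h0.2, h1.1, h1.2]

theorem convex_closedSquare : Convex ℝ closedSquare := by
  intro x hx y hy a b ha hb hab i
  exact (convex_Icc (0 : ℝ) 1) (hx i) (hy i) ha hb hab

theorem uniqueDiffOn_closedSquare : UniqueDiffOn ℝ closedSquare := by
  refine uniqueDiffOn_convex convex_closedSquare ⟨WithLp.toLp 2 fun _ => 1 / 2, ?_⟩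
  refine interior_mono openSquare_subset ?_
  rw [isOpen_openSquare.interior_eq]
  intro i
  norm_num

theorem rescale_mem_openSquare {n : ℕ} {a : Fin 2 → Fin (2 * 5 ^ n)} {x : Plane}
    (hx : x ∈ tile n a) : (2 * 5 ^ n : ℝ) • (x - corner n a) ∈ openSquare := by
  intro i
  have hs : (0 : ℝ) < 2 * 5 ^ n := by positivity
  obtain ⟨h1, h2⟩ := hx i
  refine ⟨?_, ?_⟩
  · simp only [PiLp.smul_apply, PiLp.sub_apply, smul_eq_mul]
    exact mul_pos hs (sub_pos.2 h1)
  · simp only [PiLp.smul_apply, PiLp.sub_apply, smul_eq_mul]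
    calc (2 * 5 ^ n : ℝ) * (x i - corner n a i) < 2 * 5 ^ n * (1 / (2 * 5 ^ n)) := by
          gcongr; linarith
      _ = 1 := by field_simp

/-- Every point of the open square is a limit of points of a tile along the diagonal. -/
theorem exists_tile_near (n : ℕ) {x : Plane} (hx : x ∈ openSquare) :
    ∃ a, ∀ᶠ ε in 𝓝[>] (0 : ℝ), x + WithLp.toLp 2 (fun _ => ε) ∈ tile n a := by
  have hs : (0 : ℝ) < 2 * 5 ^ n := by positivity
  have hlt : ∀ i, ⌊(2 * 5 ^ n : ℝ) * x i⌋₊ < 2 * 5 ^ n := fun i => by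
    rw [Nat.floor_lt (mul_pos hs (hx i).1).le]
    push_cast
    nlinarith [(hx i).2]
  -- The half-open cell containing x. The point may lie on its left or lower edge, and a small
  -- positive diagonal shift moves it into the interior.
  refine ⟨fun i => ⟨_, hlt i⟩, ?_⟩
  have key : ∀ i, ∀ᶠ ε in 𝓝[>] (0 : ℝ),
      (⌊(2 * 5 ^ n : ℝ) * x i⌋₊ : ℝ) / (2 * 5 ^ n) < x i + ε ∧
        x i + ε < (⌊(2 * 5 ^ n : ℝ) * x i⌋₊ : ℝ) / (2 * 5 ^ n) + 1 / (2 * 5 ^ n) := fun i => by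
    have h1 : (⌊(2 * 5 ^ n : ℝ) * x i⌋₊ : ℝ) / (2 * 5 ^ n) ≤ x i := by
      rw [div_le_iff₀ hs, mul_comm (x i)]
      exact Nat.floor_le (mul_pos hs (hx i).1).le
    have h2 : x i < (⌊(2 * 5 ^ n : ℝ) * x i⌋₊ : ℝ) / (2 * 5 ^ n) + 1 / (2 * 5 ^ n) := by
      rw [← add_div, lt_div_iff₀ hs, mul_comm (x i)]
      exact Nat.lt_floor_add_one _
    filter_upwards [Ioo_mem_nhdsGT (sub_pos.2 h2)] with ε hε
    exact ⟨by linarith [hε.1], by linarith [hε.2]⟩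
  filter_upwards [eventually_all.2 key] with ε hε i
  exact hε i

/-! ### Scaling of derivatives of quasi-self-similar families -/

section Scaled

variable {E : Type*} [NormedAddCommGroup E] [NormedSpace ℝ E]

/-- A family of smooth functions on the slab over the plane, each compactly supported in the open
square, which on every tile is `β n` times a rescaled copy of one of finitely many smooth building
blocks. -/
structure IsScaledFamily (W : QuasiSelfSimilarVelocity) (β : ℕ → ℝ) (u : ℕ → Plane × ℝ → E)
    (B : Fin W.N → Plane × ℝ → E) : Prop where
  smooth : ∀ n, ContDiffOn ℝ ∞ (u n) (slab univ)
  block_smooth : ∀ j, ContDiffOn ℝ ∞ (B j) (slab closedSquare)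
  support : ∀ n, ∃ K : Set Plane, IsCompact K ∧ K ⊆ openSquare ∧
    ∀ t ∈ Icc (0 : ℝ) 1, ∀ x, x ∉ K → u n (x, t) = 0
  tile_eq : ∀ n a, ∀ x ∈ tile n a, ∀ t ∈ Icc (0 : ℝ) 1,
    u n (x, t) = β n • B (W.idx n a) ((2 * 5 ^ n : ℝ) • (x - corner n a), t)

/-- Smoothness on the closed square passes to the whole plane because the support is compact in the
open square: near a point of K the square is a neighbourhood, and off K the field vanishes. -/
theorem QuasiSelfSimilarVelocity.isScaledFamily (W : QuasiSelfSimilarVelocity) :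
    IsScaledFamily W (fun n => 1 / (2 * 5 ^ n)) (fun n q => W.vel n q.1 q.2)
      (fun j q => W.block j q.1 q.2) := by
  refine ⟨fun n => ?_, W.block_smooth, W.vel_support, W.vel_tile⟩
  obtain ⟨K, hK, hKo, h0⟩ := W.vel_support n
  rintro ⟨x, t⟩ ⟨-, ht⟩
  by_cases hx : x ∈ K
  · have h1 := W.vel_smooth n (x, t) ⟨openSquare_subset (hKo hx), ht⟩
    refine h1.mono_of_mem_nhdsWithin ?_
    have : openSquare ×ˢ (univ : Set ℝ) ∈ 𝓝 (x, t) :=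
      (isOpen_openSquare.prod isOpen_univ).mem_nhds ⟨hKo hx, mem_univ _⟩
    filter_upwards [mem_nhdsWithin_of_mem_nhds this, self_mem_nhdsWithin] with q hq hq'
    exact ⟨openSquare_subset hq.1, hq'.2⟩
  · refine (contDiffWithinAt_const (c := (0 : Plane))).congr_of_eventuallyEq ?_ (h0 t ht x hx)
    have : Kᶜ ×ˢ (univ : Set ℝ) ∈ 𝓝 (x, t) :=
      (hK.isClosed.isOpen_compl.prod isOpen_univ).mem_nhds ⟨hx, mem_univ _⟩
    filter_upwards [mem_nhdsWithin_of_mem_nhds this, self_mem_nhdsWithin] with q hq hq'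
    exact h0 q.2 hq'.2 q.1 hq.1

namespace IsScaledFamily

variable {W : QuasiSelfSimilarVelocity} {β : ℕ → ℝ} {u : ℕ → Plane × ℝ → E}
    {B : Fin W.N → Plane × ℝ → E}

theorem hasFDerivAt (h : IsScaledFamily W β u B) (n : ℕ) (x : Plane) {t : ℝ}
    (ht : t ∈ Icc (0 : ℝ) 1) :
    HasFDerivAt (fun y => u n (y, t)) (dX univ (u n) (x, t)) x :=
  (hasFDerivWithinAt_dX (h.smooth n) (mem_univ x) ht).hasFDerivAt univ_mem

theorem hasDerivWithinAt (h : IsScaledFamily W β u B) (n : ℕ) (x : Plane) {t : ℝ}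
    (ht : t ∈ Icc (0 : ℝ) 1) :
    HasDerivWithinAt (fun s => u n (x, s)) (dT univ (u n) (x, t)) (Icc 0 1) t :=
  hasDerivWithinAt_dT (h.smooth n) (mem_univ x) ht

theorem continuous_space (h : IsScaledFamily W β u B) (n : ℕ) {t : ℝ} (ht : t ∈ Icc (0 : ℝ) 1) :
    Continuous fun x => u n (x, t) :=
  continuous_iff_continuousAt.2 fun x => (h.hasFDerivAt n x ht).continuousAt

theorem continuousOn_time (h : IsScaledFamily W β u B) (n : ℕ) (x : Plane) :
    ContinuousOn (fun t => u n (x, t)) (Icc 0 1) :=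
  fun _ ht => (h.hasDerivWithinAt n x ht).continuousWithinAt

theorem eq_zero (h : IsScaledFamily W β u B) (n : ℕ) {x : Plane} (hx : x ∉ openSquare) {t : ℝ}
    (ht : t ∈ Icc (0 : ℝ) 1) : u n (x, t) = 0 := by
  obtain ⟨K, -, hKo, h0⟩ := h.support n
  exact h0 t ht x fun hxK => hx (hKo hxK)

/-- The chain rule on an open tile produces the factor 2·5^n. Since the result is again a scaled
family, derivatives can be iterated without returning to the grid. -/
theorem dX (h : IsScaledFamily W β u B) :
    IsScaledFamily W (fun n => β n * (2 * 5 ^ n)) (fun n => dX univ (u n))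
      (fun j => ForcedNS.dX closedSquare (B j)) := by
  refine ⟨fun n => contDiffOn_dX uniqueDiffOn_univ (h.smooth n),
    fun j => contDiffOn_dX uniqueDiffOn_closedSquare (h.block_smooth j), fun n => ?_,
    fun n a x hx t ht => ?_⟩
  · obtain ⟨K, hK, hKo, h0⟩ := h.support n
    refine ⟨K, hK, hKo, fun t ht x hx => ?_⟩
    refine (h.hasFDerivAt n x ht).unique ((hasFDerivAt_const (0 : E) x).congr_of_eventuallyEq ?_)
    filter_upwards [hK.isClosed.isOpen_compl.mem_nhds hx] with y hy
    exact h0 t ht y hy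
  · have hx' := rescale_mem_openSquare hx
    have h1 := (hasFDerivWithinAt_dX (h.block_smooth (W.idx n a)) (openSquare_subset hx')
      ht).hasFDerivAt (mem_of_superset (isOpen_openSquare.mem_nhds hx') openSquare_subset)
    have h2 : HasFDerivAt (fun y : Plane => (2 * 5 ^ n : ℝ) • (y - corner n a))
        ((2 * 5 ^ n : ℝ) • ContinuousLinearMap.id ℝ Plane) x :=
      ((hasFDerivAt_id x).sub_const (corner n a)).fun_const_smul _
    have h3 := (h1.comp x h2).const_smul (β n)
    refine (h.hasFDerivAt n x ht).unique ((h3.congr_of_eventuallyEq ?_).congr_fderiv ?_)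
    · filter_upwards [(isOpen_tile n a).mem_nhds hx] with y hy
      exact h.tile_eq n a y hy t ht
    · ext v
      simp [smul_smul]

/-- The rescaling on a tile acts on x only, so the amplitude β is unchanged. -/
theorem dT (h : IsScaledFamily W β u B) :
    IsScaledFamily W β (fun n => dT univ (u n)) (fun j => ForcedNS.dT closedSquare (B j)) := by
  have hI : UniqueDiffOn ℝ (Icc (0 : ℝ) 1) := uniqueDiffOn_Icc zero_lt_one
  refine ⟨fun n => contDiffOn_dT uniqueDiffOn_univ (h.smooth n),
    fun j => contDiffOn_dT uniqueDiffOn_closedSquare (h.block_smooth j), fun n => ?_,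
    fun n a x hx t ht => ?_⟩
  · obtain ⟨K, hK, hKo, h0⟩ := h.support n
    refine ⟨K, hK, hKo, fun t ht x hx => ?_⟩
    refine (hI t ht).eq_deriv _ (h.hasDerivWithinAt n x ht)
      ((hasDerivWithinAt_const t (Icc 0 1) (0 : E)).congr (fun s hs => h0 s hs x hx)
        (h0 t ht x hx))
  · have hx' := openSquare_subset (rescale_mem_openSquare hx)
    have h1 := (hasDerivWithinAt_dT (h.block_smooth (W.idx n a)) hx' ht).const_smul (β n)
    exact (hI t ht).eq_deriv _ (h.hasDerivWithinAt n x ht)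
      (h1.congr (fun s hs => h.tile_eq n a x hx s hs) (h.tile_eq n a x hx t ht))

theorem clm {F : Type*} [NormedAddCommGroup F] [NormedSpace ℝ F] (h : IsScaledFamily W β u B)
    (L : E →L[ℝ] F) : IsScaledFamily W β (fun n q => L (u n q)) (fun j q => L (B j q)) := by
  refine ⟨fun n => L.contDiff.comp_contDiffOn (h.smooth n),
    fun j => L.contDiff.comp_contDiffOn (h.block_smooth j), fun n => ?_, fun n a x hx t ht => ?_⟩
  · obtain ⟨K, hK, hKo, h0⟩ := h.support n
    exact ⟨K, hK, hKo, fun t ht x hx => by rw [h0 t ht x hx, map_zero]⟩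
  · rw [h.tile_eq n a x hx t ht, map_smul]

/-- The finitely many blocks are bounded on a compact slab, which settles the tiles. The grid lines
belong to no tile and are reached by continuity along the diagonal. -/
theorem exists_bound (h : IsScaledFamily W β u B) :
    ∃ C : ℝ, 0 ≤ C ∧ ∀ n x, ∀ t ∈ Icc (0 : ℝ) 1, ‖u n (x, t)‖ ≤ |β n| * C := by
  have h1 : ∀ j, ∃ C : ℝ, ∀ q ∈ slab closedSquare, ‖B j q‖ ≤ C := fun j =>
    (isCompact_closedSquare.prod isCompact_Icc).exists_bound_of_continuousOn
      (h.block_smooth j).continuousOn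
  choose C hC using h1
  have hC' : ∀ j, C j ≤ ∑ i, |C i| := fun j => (le_abs_self _).trans
    (Finset.single_le_sum (f := fun i => |C i|) (fun i _ => abs_nonneg _) (Finset.mem_univ j))
  have hC0 : 0 ≤ ∑ i, |C i| := Finset.sum_nonneg fun i _ => abs_nonneg _
  refine ⟨∑ i, |C i|, hC0, fun n x t ht => ?_⟩
  by_cases hx : x ∈ openSquare
  · obtain ⟨a, ha⟩ := exists_tile_near n hx
    have hc : Tendsto (fun ε : ℝ => x + WithLp.toLp 2 (fun _ : Fin 2 => ε)) (𝓝[>] 0) (𝓝 x) := by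
      have : Continuous fun ε : ℝ => x + WithLp.toLp 2 (fun _ : Fin 2 => ε) :=
        continuous_const.add ((PiLp.continuous_toLp 2 _).comp (by fun_prop))
      have h0 : x + WithLp.toLp 2 (fun _ : Fin 2 => (0 : ℝ)) = x := by
        ext i; simp
      simpa [h0] using (this.tendsto 0).mono_left nhdsWithin_le_nhds
    refine le_of_tendsto (((h.continuous_space n ht).tendsto x).comp hc).norm ?_
    filter_upwards [ha] with ε hε
    rw [Function.comp_apply, h.tile_eq n a _ hε t ht, norm_smul, Real.norm_eq_abs]
    gcongr
    exact (hC _ _ ⟨openSquare_subset (rescale_mem_openSquare hε), ht⟩).trans (hC' _)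
  · rw [h.eq_zero n hx ht, norm_zero]
    positivity

end IsScaledFamily

end Scaled

/-! ### Gluing in time -/

section Glue

variable {E : Type*} [NormedAddCommGroup E] [NormedSpace ℝ E]

/-- At an integer t ≥ 1 the two intervals are those meeting at t; otherwise they coincide.
Properties on [0,∞) can thus be checked on closed unit intervals, where a single stage is active. -/
theorem exists_Icc_nat_union_mem_nhdsWithin {t : ℝ} (ht : 0 ≤ t) :
    ∃ j k : ℕ, t ∈ Icc (j : ℝ) (j + 1) ∧ t ∈ Icc (k : ℝ) (k + 1) ∧
      Icc (j : ℝ) (j + 1) ∪ Icc (k : ℝ) (k + 1) ∈ 𝓝[Ici 0] t := by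
  have hk1 : (⌊t⌋₊ : ℝ) ≤ t := Nat.floor_le ht
  have hk2 : t < ⌊t⌋₊ + 1 := Nat.lt_floor_add_one t
  -- At t = 0 the truncated subtraction gives 0, and [0,1] alone is a neighbourhood of 0 within
  -- [0,∞).
  refine ⟨⌈t⌉₊ - 1, ⌊t⌋₊, ?_, ⟨hk1, hk2.le⟩, ?_⟩
  · rcases ht.eq_or_lt with rfl | h0
    · simp
    · have h1 : 1 ≤ ⌈t⌉₊ := Nat.one_le_ceil_iff.2 h0
      push_cast [h1]
      exact ⟨by linarith [Nat.ceil_lt_add_one ht], by linarith [Nat.le_ceil t]⟩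
  · rcases ht.eq_or_lt with rfl | h0
    · refine mem_of_superset (inter_mem_nhdsWithin (Ici 0) (Iio_mem_nhds one_pos)) ?_
      rintro s ⟨hs, hs'⟩
      refine Or.inr ⟨?_, ?_⟩
      · simpa using hs
      · simpa using (le_of_lt hs')
    · have h1 : 1 ≤ ⌈t⌉₊ := Nat.one_le_ceil_iff.2 h0
      refine mem_nhdsWithin_of_mem_nhds ?_
      have h2 : ((⌈t⌉₊ - 1 : ℕ) : ℝ) < t := by
        push_cast [h1]
        linarith [Nat.ceil_lt_add_one ht]
      filter_upwards [Ioo_mem_nhds h2 hk2] with s hs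
      rcases le_total s t with hst | hst
      · refine Or.inl ⟨hs.1.le, hst.trans ?_⟩
        push_cast [h1]
        linarith [Nat.le_ceil t]
      · exact Or.inr ⟨hk1.trans hst, hs.2.le⟩

theorem continuousOn_Ici_of_Icc_nat {F : Type*} [TopologicalSpace F] {f : ℝ → F}
    (h : ∀ k : ℕ, ContinuousOn f (Icc (k : ℝ) (k + 1))) : ContinuousOn f (Ici 0) := by
  intro t ht
  obtain ⟨j, k, hj, hk, hm⟩ := exists_Icc_nat_union_mem_nhdsWithin ht
  exact ((h j t hj).union (h k t hk)).mono_of_mem_nhdsWithin hm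

theorem hasDerivWithinAt_Ici_of_Icc_nat {f f' : ℝ → E}
    (h : ∀ k : ℕ, ∀ t ∈ Icc (k : ℝ) (k + 1), HasDerivWithinAt f (f' t) (Icc (k : ℝ) (k + 1)) t)
    {t : ℝ} (ht : 0 ≤ t) : HasDerivWithinAt f (f' t) (Ici 0) t := by
  obtain ⟨j, k, hj, hk, hm⟩ := exists_Icc_nat_union_mem_nhdsWithin ht
  exact ((h j t hj).union (h k t hk)).mono_of_mem_nhdsWithin hm

/-- The first derivative of a time reparametrization. -/
noncomputable def eta1 (η : ℝ → ℝ) : ℝ → ℝ := derivWithin η (Ici 0)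

/-- The second derivative of a time reparametrization. -/
noncomputable def eta2 (η : ℝ → ℝ) : ℝ → ℝ := derivWithin (eta1 η) (Ici 0)

/-- `∑ₙ η'(t) χ_{[n,n+1)}(η(t)) φₙ(η(t) - n)`. -/
noncomputable def glue (η : ℝ → ℝ) (φ : ℕ → ℝ → E) (t : ℝ) : E :=
  ∑' n : ℕ, (Ico (n : ℝ) (n + 1)).indicator (fun s => eta1 η t • φ n (s - n)) (η t)

/-- The time derivative of `glue η φ` if `ψₙ` is the derivative of `φₙ`. -/
noncomputable def glueDeriv (η : ℝ → ℝ) (φ ψ : ℕ → ℝ → E) (t : ℝ) : E :=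
  eta2 η t • φ ⌊t⌋₊ (η t - ⌊t⌋₊) + eta1 η t ^ 2 • ψ ⌊t⌋₊ (η t - ⌊t⌋₊)

namespace IsTimeReparam

variable {η : ℝ → ℝ}

theorem hasDerivWithinAt (hη : IsTimeReparam η) {t : ℝ} (ht : 0 ≤ t) : HasDerivWithinAt η
    (eta1 η t) (Ici 0) t :=
  (hη.smooth.differentiableOn (by simp) t ht).hasDerivWithinAt

theorem contDiffOn_eta1 (hη : IsTimeReparam η) : ContDiffOn ℝ ∞ (eta1 η) (Ici 0) :=
  hη.smooth.derivWithin (uniqueDiffOn_Ici 0) (by simp)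

theorem hasDerivWithinAt_eta1 (hη : IsTimeReparam η) {t : ℝ} (ht : 0 ≤ t) :
    HasDerivWithinAt (eta1 η) (eta2 η t) (Ici 0) t :=
  (hη.contDiffOn_eta1.differentiableOn (by simp) t ht).hasDerivWithinAt

theorem continuousOn_eta2 (hη : IsTimeReparam η) : ContinuousOn (eta2 η) (Ici 0) :=
  (hη.contDiffOn_eta1.derivWithin (m := ∞) (uniqueDiffOn_Ici 0) (by simp)).continuousOn

theorem _root_.ForcedNS.iteratedDerivWithin_one_eq_eta1 (t : ℝ) : iteratedDerivWithin 1 η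
    (Ici 0) t = eta1 η t := by
  rw [iteratedDerivWithin_one, eta1]

theorem _root_.ForcedNS.iteratedDerivWithin_two_eq_eta2 (t : ℝ) : iteratedDerivWithin 2 η
    (Ici 0) t = eta2 η t := by
  rw [iteratedDerivWithin_succ, eta2]
  congr 1
  ext s
  exact iteratedDerivWithin_one_eq_eta1 s

theorem eta1_nat (hη : IsTimeReparam η) (n : ℕ) :
    eta1 η n = 0 := by rw [← iteratedDerivWithin_one_eq_eta1, hη.flat n 1 le_rfl]

theorem eta2_nat (hη : IsTimeReparam η) (n : ℕ) :
    eta2 η n = 0 := by rw [← iteratedDerivWithin_two_eq_eta2, hη.flat n 2 one_le_two]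

theorem exists_bound (hη : IsTimeReparam η) :
    ∃ C : ℝ, 1 ≤ C ∧ ∀ t, 0 ≤ t → |eta1 η t| ≤ C ∧ |eta2 η t| ≤ C := by
  obtain ⟨C1, h1⟩ := hη.bounded 1 le_rfl
  obtain ⟨C2, h2⟩ := hη.bounded 2 one_le_two
  refine ⟨max 1 (max C1 C2), le_max_left _ _, fun t ht => ⟨?_, ?_⟩⟩
  · rw [← iteratedDerivWithin_one_eq_eta1]
    exact (h1 t ht).trans ((le_max_left _ _).trans (le_max_right _ _))
  · rw [← iteratedDerivWithin_two_eq_eta2]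
    exact (h2 t ht).trans ((le_max_right _ _).trans (le_max_right _ _))

theorem map_Icc (hη : IsTimeReparam η) {k : ℕ} {t : ℝ} (ht : t ∈ Icc (k : ℝ) (k + 1)) :
    η t ∈ Icc (k : ℝ) (k + 1) := by
  have h0 : (0 : ℝ) ≤ k := k.cast_nonneg
  have h1 := hη.mono h0 (h0.trans ht.1) ht.1
  have h2 := hη.mono (h0.trans ht.1) (by simp only [mem_Ici]; positivity) ht.2
  have h3 := hη.map_nat (k + 1)
  push_cast at h3
  rw [hη.map_nat] at h1
  rw [h3] at h2
  exact ⟨h1, h2⟩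

theorem sub_mem_Icc (hη : IsTimeReparam η) {k : ℕ} {t : ℝ} (ht : t ∈ Icc (k : ℝ) (k + 1)) :
    η t - k ∈ Icc (0 : ℝ) 1 :=
  ⟨sub_nonneg.2 (hη.map_Icc ht).1, by linarith [(hη.map_Icc ht).2]⟩

/-- η may reach k+1 before time k+1. Monotonicity then keeps it constant up to k+1, so its
derivative vanishes. -/
theorem eta1_eq_zero (hη : IsTimeReparam η) {k : ℕ} {t : ℝ} (ht : t ∈ Icc (k : ℝ) (k + 1))
    (h : η t = k + 1) :
    eta1 η t = 0 := by
  rcases ht.2.eq_or_lt with rfl | hlt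
  · exact_mod_cast hη.eta1_nat (k + 1)
  · have h0 : (0 : ℝ) ≤ t := k.cast_nonneg.trans ht.1
    have hconst : ∀ s ∈ Icc t (k + 1), η s = k + 1 := fun s hs => by
      refine le_antisymm (hη.map_Icc ⟨ht.1.trans hs.1, hs.2⟩).2 ?_
      rw [← h]
      exact hη.mono h0 (h0.trans hs.1) hs.1
    have hm : t ∈ Icc t ((k : ℝ) + 1) := left_mem_Icc.2 hlt.le
    exact (uniqueDiffOn_Icc hlt t hm).eq_deriv _
      ((hη.hasDerivWithinAt h0).mono fun s hs => h0.trans hs.1)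
      ((hasDerivWithinAt_const t _ ((k : ℝ) + 1)).congr hconst (hconst t hm))

/-- Valid on the closed interval: when η t = k+1 the indicator selects the next stage, but the
prefactor η' is zero there, so the choice of stage is immaterial. -/
theorem glue_eq (hη : IsTimeReparam η) (φ : ℕ → ℝ → E) {k : ℕ} {t : ℝ}
    (ht : t ∈ Icc (k : ℝ) (k + 1)) :
    glue η φ t = eta1 η t • φ k (η t - k) := by
  have h := hη.map_Icc ht
  rcases h.2.eq_or_lt with heq | hlt
  · simp [glue, hη.eta1_eq_zero ht heq]
  · have hmem : η t ∈ Ico (k : ℝ) (k + 1) := ⟨h.1, hlt⟩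
    rw [glue, tsum_eq_single k, indicator_of_mem hmem]
    intro n hn
    refine indicator_of_notMem (fun hmem => hn ?_) _
    have h1 : (n : ℝ) < k + 1 := hmem.1.trans_lt hlt
    have h2 : (k : ℝ) < n + 1 := h.1.trans_lt hmem.2
    norm_cast at h1 h2
    omega

/-- At t = k+1 the floor jumps to the next stage; flatness of η makes both η' and η'' vanish there,
so the two formulas agree. -/
theorem glueDeriv_eq (hη : IsTimeReparam η) (φ ψ : ℕ → ℝ → E) {k : ℕ} {t : ℝ}
    (ht : t ∈ Icc (k : ℝ) (k + 1)) :
    glueDeriv η φ ψ t = eta2 η t • φ k (η t - k) + eta1 η t ^ 2 • ψ k (η t - k) := by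
  rcases ht.2.eq_or_lt with heq | hlt
  · have h1 : eta1 η t = 0 := by rw [heq]; exact_mod_cast hη.eta1_nat (k + 1)
    have h2 : eta2 η t = 0 := by rw [heq]; exact_mod_cast hη.eta2_nat (k + 1)
    simp [glueDeriv, h1, h2]
  · have : ⌊t⌋₊ = k := (Nat.floor_eq_iff (k.cast_nonneg.trans ht.1)).2 ⟨ht.1, hlt⟩
    rw [glueDeriv, this]

theorem continuousOn_comp_sub {F : Type*} [TopologicalSpace F] (hη : IsTimeReparam η)
    {f : ℝ → F} (hf : ContinuousOn f (Icc 0 1)) (k : ℕ) :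
    ContinuousOn (fun t => f (η t - k)) (Icc (k : ℝ) (k + 1)) := by
  refine hf.comp ((hη.smooth.continuousOn.mono ?_).sub continuousOn_const)
    fun t ht => hη.sub_mem_Icc ht
  exact fun s hs => k.cast_nonneg.trans hs.1

theorem continuousOn_glueDeriv (hη : IsTimeReparam η) {φ ψ : ℕ → ℝ → E}
    (hφ : ∀ k, ContinuousOn (φ k) (Icc 0 1))
    (hψ : ∀ k, ContinuousOn (ψ k) (Icc 0 1)) : ContinuousOn (glueDeriv η φ ψ) (Ici 0) := by
  refine continuousOn_Ici_of_Icc_nat fun k => ?_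
  have hsub : Icc (k : ℝ) (k + 1) ⊆ Ici 0 := fun s hs => k.cast_nonneg.trans hs.1
  exact (((hη.continuousOn_eta2.mono hsub).smul (hη.continuousOn_comp_sub (hφ k) k)).add
    (((hη.contDiffOn_eta1.continuousOn.mono hsub).pow 2).smul
    (hη.continuousOn_comp_sub (hψ k) k))).congr fun t ht => hη.glueDeriv_eq φ ψ ht

/-- Product and chain rule on each closed unit interval. `glueDeriv` has the same value from both
sides of an integer, so the one-sided derivatives match. -/
theorem hasDerivWithinAt_glue (hη : IsTimeReparam η) {φ ψ : ℕ → ℝ → E}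
    (h : ∀ k, ∀ r ∈ Icc (0 : ℝ) 1, HasDerivWithinAt (φ k) (ψ k r) (Icc 0 1) r) {t : ℝ}
    (ht : 0 ≤ t) : HasDerivWithinAt (glue η φ) (glueDeriv η φ ψ t) (Ici 0) t := by
  refine hasDerivWithinAt_Ici_of_Icc_nat (fun k t ht => ?_) ht
  have hsub : Icc (k : ℝ) (k + 1) ⊆ Ici 0 := fun s hs => k.cast_nonneg.trans hs.1
  have h1 := (hη.hasDerivWithinAt_eta1 (hsub ht)).mono hsub
  have h2 := ((hη.hasDerivWithinAt (hsub ht)).mono hsub).sub_const (k : ℝ)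
  have h3 := (h k _ (hη.sub_mem_Icc ht)).scomp t h2 fun s hs => hη.sub_mem_Icc hs
  refine ((h1.fun_smul h3).congr (fun s hs => hη.glue_eq φ hs) (hη.glue_eq φ ht)).congr_deriv ?_
  rw [hη.glueDeriv_eq φ ψ ht, smul_smul, sq, add_comm]
  rfl

end IsTimeReparam

end Glue

/-! ### Periodic extension -/

section Periodic

/-- The square `(1/4, 3/4)²`. -/
def innerSquare : Set Plane := {x | ∀ i, x i ∈ Ioo (1 / 4 : ℝ) (3 / 4)}

/-- The periodic extension of a function supported in `(1/4,3/4)²` is locally a translate of the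
function. -/
theorem comp_fractPt_eventuallyEq {E : Type*} [Zero E] {f : Plane → E}
    (hf : ∀ x, x ∉ innerSquare → f x = 0) (x : Plane) :
    (fun y => f (fractPt y)) =ᶠ[𝓝 x] fun y => f (y - (x - fractPt x)) := by
  have hnear : ∀ᶠ y in 𝓝 x, ∀ i, |y i - x i| < 1 / 8 := by
    refine eventually_all.2 fun i => ?_
    have : Tendsto (fun y : Plane => |y i - x i|) (𝓝 x) (𝓝 |x i - x i|) :=
      (((continuous_coord i).sub continuous_const).abs).tendsto x
    rw [sub_self, abs_zero] at this
    exact this.eventually_lt_const (by norm_num)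
  filter_upwards [hnear] with y hy
  have hco : ∀ i, (y - (x - fractPt x)) i = y i - ⌊x i⌋ := fun i => by
    simp only [fractPt, PiLp.sub_apply, Int.fract]
    ring
  -- Either y lies in the same cell as x and the floors agree, or y has crossed a cell edge. In the
  -- second case some coordinate is within 1/8 of an integer, so both arguments miss the inner
  -- square and both values are zero.
  by_cases h : ∀ i, y i - ⌊x i⌋ ∈ Ico (0 : ℝ) 1
  · congr 1
    ext i
    rw [hco]
    have : ⌊y i⌋ = ⌊x i⌋ := by
      rw [Int.floor_eq_iff]
      exact ⟨by linarith [(h i).1], by linarith [(h i).2]⟩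
    simp only [fractPt, Int.fract, this]
  · obtain ⟨i, hi⟩ := not_forall.1 h
    have h1 := Int.floor_le (x i)
    have h2 := Int.lt_floor_add_one (x i)
    have h3 := abs_lt.1 (hy i)
    rw [hf, hf]
    · intro hmem
      have h4 := hmem i
      rw [hco] at h4
      exact hi ⟨by linarith [h4.1], by linarith [h4.2]⟩
    · intro hmem
      have h4 : Int.fract (y i) ∈ Ioo (1 / 4 : ℝ) (3 / 4) := hmem i
      have h5 := Int.floor_add_fract (y i)
      rcases lt_trichotomy ⌊y i⌋ ⌊x i⌋ with h6 | h6 | h6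
      · have h7 : (⌊y i⌋ : ℝ) + 1 ≤ ⌊x i⌋ := by exact_mod_cast h6
        linarith [h4.1, h4.2, h3.1, h3.2]
      · refine hi ⟨?_, ?_⟩ <;> rw [← h6] <;> linarith [h4.1, h4.2]
      · have h7 : (⌊x i⌋ : ℝ) + 1 ≤ ⌊y i⌋ := by exact_mod_cast h6
        linarith [h4.1, h4.2, h3.1, h3.2]

theorem hasFDerivAt_comp_fractPt {E : Type*} [NormedAddCommGroup E] [NormedSpace ℝ E]
    {f : Plane → E} (hf : ∀ x, x ∉ innerSquare → f x = 0) {x : Plane} {f' : Plane →L[ℝ] E}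
    (h : HasFDerivAt f f' (fractPt x)) : HasFDerivAt (fun y => f (fractPt y)) f' x := by
  refine HasFDerivAt.congr_of_eventuallyEq ?_ (comp_fractPt_eventuallyEq hf x)
  have h1 : HasFDerivAt (fun y : Plane => y - (x - fractPt x)) (ContinuousLinearMap.id ℝ Plane) x :=
    (hasFDerivAt_id x).sub_const _
  have h2 : x - (x - fractPt x) = fractPt x := sub_sub_cancel _ _
  have h3 : HasFDerivAt f f' (x - (x - fractPt x)) := by rwa [h2]
  have h4 := h3.comp x h1
  rwa [ContinuousLinearMap.comp_id] at h4

theorem fractPt_add_int (x : Plane) (k : Fin 2 → ℤ) :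
    fractPt (x + WithLp.toLp 2 fun i => (k i : ℝ)) = fractPt x := by
  ext i
  simp [fractPt]

end Periodic

/-! ### Rescaled glued families -/

section Rescaled

variable {E : Type*} [NormedAddCommGroup E] [NormedSpace ℝ E]

theorem lam_pos (n : ℕ) : 0 < lam n := by unfold lam; positivity

theorem tau_nonneg (n : ℕ) : 0 ≤ tau n := by unfold tau; positivity

theorem div_tau_nonneg {t : ℝ} (ht : t ∈ Icc (0 : ℝ) 1) (n : ℕ) : 0 ≤ t / tau n :=
  div_nonneg ht.1 (tau_nonneg n)

/-- The point `(x - xₙ) / λₙ`. -/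
noncomputable def zoom (c : ℕ → Plane) (n : ℕ) (x : Plane) : Plane := (1 / lam n) • (x - c n)

theorem mem_cube_of_zoom {c : ℕ → Plane} {n : ℕ} {x : Plane} (h : zoom c n x ∈ openSquare) :
    x ∈ cube c n := by
  intro i
  have h1 : 0 < 1 / lam n * (x i - c n i) ∧ 1 / lam n * (x i - c n i) < 1 := h i
  have h2 := lam_pos n
  rw [one_div_mul_eq_div, div_lt_one h2] at h1
  have h3 : 0 < x i - c n i := by
    by_contra hneg
    exact absurd h1.1 (not_lt.2 (div_nonpos_of_nonpos_of_nonneg (not_lt.1 hneg) h2.le))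
  rw [abs_of_pos h3]
  linarith

/-- The glued family `u`, rescaled to the cube with index `n` and extended periodically. -/
noncomputable def scaled (η : ℝ → ℝ) (c : ℕ → Plane) (u : ℕ → Plane × ℝ → E) (n : ℕ)
    (x : Plane) (t : ℝ) : E :=
  glue η (fun k r => u k (zoom c n (fractPt x), r)) (t / tau n)

/-- The field `scaled`, with `glue` replaced by `glueDeriv`. -/
noncomputable def scaledDeriv (η : ℝ → ℝ) (c : ℕ → Plane) (u w : ℕ → Plane × ℝ → E) (n : ℕ)
    (x : Plane) (t : ℝ) : E :=
  glueDeriv η (fun k r => u k (zoom c n (fractPt x), r))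
    (fun k r => w k (zoom c n (fractPt x), r)) (t / tau n)

variable {η : ℝ → ℝ} {c : ℕ → Plane} {W : QuasiSelfSimilarVelocity} {β γ : ℕ → ℝ}
  {u w : ℕ → Plane × ℝ → E} {B B' : Fin W.N → Plane × ℝ → E}

theorem mem_Icc_floor {s : ℝ} (hs : 0 ≤ s) : s ∈ Icc (⌊s⌋₊ : ℝ) (⌊s⌋₊ + 1) :=
  ⟨Nat.floor_le hs, (Nat.lt_floor_add_one s).le⟩

theorem scaled_eq (hη : IsTimeReparam η) (u : ℕ → Plane × ℝ → E) (n : ℕ) (x : Plane) {t : ℝ}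
    (ht : t ∈ Icc (0 : ℝ) 1) : scaled η c u n x t = eta1 η (t / tau n) •
      u ⌊t / tau n⌋₊ (zoom c n (fractPt x), η (t / tau n) - ⌊t / tau n⌋₊) :=
  hη.glue_eq _ (mem_Icc_floor (div_tau_nonneg ht n))

theorem reparam_mem_Icc (hη : IsTimeReparam η) (n : ℕ) {t : ℝ} (ht : t ∈ Icc (0 : ℝ) 1) :
    η (t / tau n) - ⌊t / tau n⌋₊ ∈ Icc (0 : ℝ) 1 :=
  hη.sub_mem_Icc (mem_Icc_floor (div_tau_nonneg ht n))

theorem scaled_eq_zero (hη : IsTimeReparam η) (hu : IsScaledFamily W β u B) {n : ℕ} {x : Plane}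
    (hx : fractPt x ∉ cube c n) {t : ℝ} (ht : t ∈ Icc (0 : ℝ) 1) : scaled η c u n x t = 0 := by
  rw [scaled_eq hη u n x ht, hu.eq_zero _ (fun h => hx (mem_cube_of_zoom h))
    (reparam_mem_Icc hη n ht), smul_zero]

theorem scaledDeriv_eq_zero (hη : IsTimeReparam η) (hu : IsScaledFamily W β u B)
    (hw : IsScaledFamily W γ w B') {n : ℕ} {x : Plane} (hx : fractPt x ∉ cube c n) {t : ℝ}
    (ht : t ∈ Icc (0 : ℝ) 1) : scaledDeriv η c u w n x t = 0 := by
  have h := fun h => hx (mem_cube_of_zoom h)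
  rw [scaledDeriv, glueDeriv, hu.eq_zero _ h (reparam_mem_Icc hη n ht),
    hw.eq_zero _ h (reparam_mem_Icc hη n ht), smul_zero, smul_zero, add_zero]

theorem zoom_eq_zero (hc : IsCubeCentres c) {n : ℕ} (hn : 1 ≤ n) (hu : IsScaledFamily W β u B)
    (k : ℕ) {r : ℝ} (hr : r ∈ Icc (0 : ℝ) 1) {x : Plane} (hx : x ∉ innerSquare) :
    u k (zoom c n x, r) = 0 :=
  hu.eq_zero k (fun h => hx fun i => hc.inside n hn x (mem_cube_of_zoom h) i) hr

theorem hasFDerivAt_zoom (hc : IsCubeCentres c) {n : ℕ} (hn : 1 ≤ n)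
    (hu : IsScaledFamily W β u B) (k : ℕ) {r : ℝ} (hr : r ∈ Icc (0 : ℝ) 1) (x : Plane) :
    HasFDerivAt (fun y => u k (zoom c n (fractPt y), r))
      ((1 / lam n) • dX univ (u k) (zoom c n (fractPt x), r)) x := by
  refine hasFDerivAt_comp_fractPt (f := fun y => u k (zoom c n y, r))
    (fun y hy => zoom_eq_zero hc hn hu k hr hy) ?_
  have h2 : HasFDerivAt (zoom c n) ((1 / lam n) • ContinuousLinearMap.id ℝ Plane) (fractPt x) :=
    ((hasFDerivAt_id (fractPt x)).sub_const (c n)).fun_const_smul _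
  refine ((hu.hasFDerivAt k (zoom c n (fractPt x)) hr).comp (fractPt x) h2).congr_fderiv ?_
  ext v
  simp

theorem hasFDerivAt_scaled (hη : IsTimeReparam η) (hc : IsCubeCentres c)
    (hu : IsScaledFamily W β u B) {n : ℕ} (hn : 1 ≤ n) (x : Plane) {t : ℝ}
    (ht : t ∈ Icc (0 : ℝ) 1) :
    HasFDerivAt (fun y => scaled η c u n y t)
      ((1 / lam n) • scaled η c (fun k => dX univ (u k)) n x t) x := by
  simp only [scaled_eq hη _ n _ ht]
  rw [smul_comm]
  exact (hasFDerivAt_zoom hc hn hu _ (reparam_mem_Icc hη n ht) x).fun_const_smul _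

theorem hasFDerivAt_scaledDeriv (hη : IsTimeReparam η) (hc : IsCubeCentres c)
    (hu : IsScaledFamily W β u B) (hw : IsScaledFamily W γ w B') {n : ℕ} (hn : 1 ≤ n)
    (x : Plane) {t : ℝ} (ht : t ∈ Icc (0 : ℝ) 1) :
    HasFDerivAt (fun y => scaledDeriv η c u w n y t)
      ((1 / lam n) • scaledDeriv η c (fun k => dX univ (u k)) (fun k => dX univ (w k)) n x t)
      x := by
  simp only [scaledDeriv, glueDeriv]
  rw [smul_add, smul_comm, smul_comm (1 / lam n)]
  exact ((hasFDerivAt_zoom hc hn hu _ (reparam_mem_Icc hη n ht) x).fun_const_smul _).fun_add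
    ((hasFDerivAt_zoom hc hn hw _ (reparam_mem_Icc hη n ht) x).fun_const_smul _)

theorem continuous_scaled (hη : IsTimeReparam η) (hc : IsCubeCentres c)
    (hu : IsScaledFamily W β u B) {n : ℕ} (hn : 1 ≤ n) {t : ℝ} (ht : t ∈ Icc (0 : ℝ) 1) :
    Continuous fun x => scaled η c u n x t :=
  continuous_iff_continuousAt.2 fun x => (hasFDerivAt_scaled hη hc hu hn x ht).continuousAt

theorem continuous_scaledDeriv (hη : IsTimeReparam η) (hc : IsCubeCentres c)
    (hu : IsScaledFamily W β u B) (hw : IsScaledFamily W γ w B') {n : ℕ} (hn : 1 ≤ n) {t : ℝ}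
    (ht : t ∈ Icc (0 : ℝ) 1) : Continuous fun x => scaledDeriv η c u w n x t :=
  continuous_iff_continuousAt.2 fun x =>
    (hasFDerivAt_scaledDeriv hη hc hu hw hn x ht).continuousAt

theorem hasDerivWithinAt_scaled (hη : IsTimeReparam η) (hu : IsScaledFamily W β u B) (n : ℕ)
    (x : Plane) {t : ℝ} (ht : t ∈ Icc (0 : ℝ) 1) :
    HasDerivWithinAt (scaled η c u n x)
      ((1 / tau n) • scaledDeriv η c u (fun k => dT univ (u k)) n x t) (Icc 0 1) t := by
  have h1 := hη.hasDerivWithinAt_glue (φ := fun k r => u k (zoom c n (fractPt x), r))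
    (ψ := fun k r => dT univ (u k) (zoom c n (fractPt x), r))
    (fun k r hr => hu.hasDerivWithinAt k _ hr) (div_tau_nonneg ht n)
  have h2 : HasDerivWithinAt (fun s => s / tau n) (1 / tau n) (Icc 0 1) t :=
    (hasDerivWithinAt_id t _).div_const _
  exact h1.scomp t h2 fun s hs => div_tau_nonneg hs n

theorem continuousOn_scaled (hη : IsTimeReparam η) (hu : IsScaledFamily W β u B) (n : ℕ)
    (x : Plane) : ContinuousOn (scaled η c u n x) (Icc 0 1) :=
  fun _ ht => (hasDerivWithinAt_scaled hη hu n x ht).continuousWithinAt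

theorem continuousOn_scaledDeriv (hη : IsTimeReparam η) (hu : IsScaledFamily W β u B)
    (hw : IsScaledFamily W γ w B') (n : ℕ) (x : Plane) :
    ContinuousOn (scaledDeriv η c u w n x) (Icc 0 1) :=
  (hη.continuousOn_glueDeriv (fun k => hu.continuousOn_time k _)
    (fun k => hw.continuousOn_time k _)).comp
    (continuousOn_id.div_const _) fun _ hs => div_tau_nonneg hs n

end Rescaled

/-! ### The fields on a single cube -/

theorem lam_le_one (n : ℕ) : lam n ≤ 1 := by
  have : Real.exp (-(n : ℝ)) ≤ 1 := Real.exp_le_one_iff.2 (by simp)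
  unfold lam
  linarith [Real.exp_pos (-(n : ℝ))]

theorem one_div_tau (n : ℕ) : 1 / tau n = (n : ℝ) ^ 3 := by simp [tau]

/-- 1/τ_n = n³ turns the real power into 25^(-n³). With 1/0 = 0 this holds for n = 0 too, as do the
bounds built on it. -/
theorem nu_eq (n : ℕ) : nu n = lam n ^ 2 * tau n * ((25 : ℝ) ^ n ^ 3)⁻¹ := by
  have h : -2 / tau n = -((2 * n ^ 3 : ℕ) : ℝ) := by
    rw [← mul_one_div, one_div_tau]
    push_cast
    ring
  rw [nu, h, Real.rpow_neg (by norm_num), Real.rpow_natCast, pow_mul]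
  norm_num

theorem one_div_nu (n : ℕ) : 1 / nu n = (n : ℝ) ^ 3 / lam n ^ 2 * 25 ^ n ^ 3 := by
  rw [nu_eq, ← one_div_tau]
  simp only [one_div, mul_inv, inv_inv]
  ring

/-- On [0,1] the n-th cube sees only the stages up to n³; this caps the spatial frequency at
2·5^(n³). -/
theorem floor_div_tau_le {t : ℝ} (ht : t ∈ Icc (0 : ℝ) 1) (n : ℕ) : ⌊t / tau n⌋₊ ≤ n ^ 3 := by
  refine Nat.floor_le_of_le ?_
  rw [← mul_one_div, one_div_tau]
  push_cast
  exact mul_le_of_le_one_left (by positivity) ht.2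

section Fields

/-- The usual operator norms; no new structure is introduced. -/
noncomputable instance instNormedAddCommGroupLin : NormedAddCommGroup (Plane →L[ℝ] Plane) :=
  ContinuousLinearMap.toNormedAddCommGroup

noncomputable instance instNormedSpaceLin : NormedSpace ℝ (Plane →L[ℝ] Plane) :=
  ContinuousLinearMap.toNormedSpace

noncomputable instance instNormedAddCommGroupBilin :
    NormedAddCommGroup (Plane →L[ℝ] Plane →L[ℝ] Plane) :=
  ContinuousLinearMap.toNormedAddCommGroup

noncomputable instance instNormedSpaceBilin : NormedSpace ℝ (Plane →L[ℝ] Plane →L[ℝ] Plane) :=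
  ContinuousLinearMap.toNormedSpace

/-- The velocities of `W` as functions on space-time. -/
def QuasiSelfSimilarVelocity.field (W : QuasiSelfSimilarVelocity) (k : ℕ) (q : Plane × ℝ) : Plane :=
  W.vel k q.1 q.2

variable (W : QuasiSelfSimilarVelocity) (η : ℝ → ℝ) (c : ℕ → Plane)

/-- The periodic extension of `scaledVel`. -/
noncomputable def fieldF (n : ℕ) (x : Plane) (t : ℝ) : Plane :=
  (lam n / tau n) • scaled η c W.field n x t

/-- The spatial derivative of `fieldF`. -/
noncomputable def fieldDF (n : ℕ) (x : Plane) (t : ℝ) : Plane →L[ℝ] Plane :=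
  (1 / tau n) • scaled η c (fun k => dX univ (W.field k)) n x t

/-- The second spatial derivative of `fieldF`. -/
noncomputable def fieldD2F (n : ℕ) (x : Plane) (t : ℝ) : Plane →L[ℝ] Plane →L[ℝ] Plane :=
  (1 / (tau n * lam n)) • scaled η c (fun k => dX univ (dX univ (W.field k))) n x t

/-- The time derivative of `fieldF`. -/
noncomputable def fieldFt (n : ℕ) (x : Plane) (t : ℝ) : Plane :=
  (lam n / tau n ^ 2) • scaledDeriv η c W.field (fun k => dT univ (W.field k)) n x t

/-- The spatial derivative of `fieldFt`. -/
noncomputable def fieldDFt (n : ℕ) (x : Plane) (t : ℝ) : Plane →L[ℝ] Plane :=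
  (1 / tau n ^ 2) • scaledDeriv η c (fun k => dX univ (W.field k))
    (fun k => dX univ (dT univ (W.field k))) n x t

/-- The trace of a vector valued bilinear map. -/
noncomputable def bilinTrace : (Plane →L[ℝ] Plane →L[ℝ] Plane) →L[ℝ] Plane :=
  ∑ i : Fin 2, (ContinuousLinearMap.apply ℝ Plane (EuclideanSpace.single i (1 : ℝ))).comp
    (ContinuousLinearMap.apply ℝ (Plane →L[ℝ] Plane) (EuclideanSpace.single i (1 : ℝ)))

/-- The Laplacians of the velocities of `W`. -/
noncomputable def QuasiSelfSimilarVelocity.fieldLap (W : QuasiSelfSimilarVelocity) (k : ℕ)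
    (q : Plane × ℝ) : Plane :=
  bilinTrace (dX univ (dX univ (W.field k)) q)

/-- The Euler force `∂ₜ F + F · ∇ F` on a single cube. -/
noncomputable def eulerPiece (n : ℕ) (x : Plane) (t : ℝ) : Plane :=
  fieldFt W η c n x t + fieldDF W η c n x t (fieldF W η c n x t)

/-- The spatial derivative of `eulerPiece`. -/
noncomputable def gradEulerPiece (n : ℕ) (x : Plane) (t : ℝ) : Plane →L[ℝ] Plane :=
  fieldDFt W η c n x t + ((fieldDF W η c n x t).comp (fieldDF W η c n x t) +
    (fieldD2F W η c n x t).flip (fieldF W η c n x t))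

/-- The Laplacian of the velocity on a single cube. -/
noncomputable def lapPiece (n : ℕ) (x : Plane) (t : ℝ) : Plane :=
  (1 / (tau n * lam n)) • scaled η c W.fieldLap n x t

/-- The spatial derivative of `lapPiece`. -/
noncomputable def gradLapPiece (n : ℕ) (x : Plane) (t : ℝ) : Plane →L[ℝ] Plane :=
  (1 / (tau n * lam n ^ 2)) • scaled η c (fun k => dX univ (W.fieldLap k)) n x t

variable {W η c}

theorem QuasiSelfSimilarVelocity.isScaledFamily_field (W : QuasiSelfSimilarVelocity) :
    IsScaledFamily W (fun n => 1 / (2 * 5 ^ n)) W.field (fun j q => W.block j q.1 q.2) :=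
  W.isScaledFamily

theorem QuasiSelfSimilarVelocity.exists_isScaledFamily_fieldLap (W : QuasiSelfSimilarVelocity) :
    ∃ B, IsScaledFamily W (fun n => 1 / (2 * 5 ^ n) * (2 * 5 ^ n) * (2 * 5 ^ n)) W.fieldLap B :=
  ⟨_, W.isScaledFamily_field.dX.dX.clm bilinTrace⟩

theorem lapPiece_eq (hη : IsTimeReparam η) (n : ℕ) (x : Plane) {t : ℝ}
    (ht : t ∈ Icc (0 : ℝ) 1) : lapPiece W η c n x t = bilinTrace (fieldD2F W η c n x t) := by
  rw [lapPiece, fieldD2F, scaled_eq hη _ n x ht, scaled_eq hη _ n x ht, map_smul, map_smul]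
  rfl

/-! #### Derivatives -/

theorem hasFDerivAt_fieldF (hη : IsTimeReparam η) (hc : IsCubeCentres c) {n : ℕ} (hn : 1 ≤ n)
    (x : Plane) {t : ℝ} (ht : t ∈ Icc (0 : ℝ) 1) :
    HasFDerivAt (fun y => fieldF W η c n y t) (fieldDF W η c n x t) x := by
  have h := (hasFDerivAt_scaled hη hc W.isScaledFamily_field hn x ht).fun_const_smul
    (lam n / tau n)
  refine h.congr_fderiv ?_
  have := (lam_pos n).ne'
  rw [fieldDF, smul_smul]
  congr 1
  field_simp

theorem hasFDerivAt_fieldDF (hη : IsTimeReparam η) (hc : IsCubeCentres c) {n : ℕ} (hn : 1 ≤ n)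
    (x : Plane) {t : ℝ} (ht : t ∈ Icc (0 : ℝ) 1) :
    HasFDerivAt (fun y => fieldDF W η c n y t) (fieldD2F W η c n x t) x := by
  have h := (hasFDerivAt_scaled hη hc W.isScaledFamily_field.dX hn x ht).fun_const_smul
    (1 / tau n)
  refine h.congr_fderiv ?_
  rw [fieldD2F, smul_smul, one_div_mul_one_div]

theorem hasFDerivAt_fieldFt (hη : IsTimeReparam η) (hc : IsCubeCentres c) {n : ℕ} (hn : 1 ≤ n)
    (x : Plane) {t : ℝ} (ht : t ∈ Icc (0 : ℝ) 1) :
    HasFDerivAt (fun y => fieldFt W η c n y t) (fieldDFt W η c n x t) x := by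
  have h := (hasFDerivAt_scaledDeriv hη hc W.isScaledFamily_field W.isScaledFamily_field.dT hn x
    ht).fun_const_smul (lam n / tau n ^ 2)
  refine h.congr_fderiv ?_
  have := (lam_pos n).ne'
  rw [fieldDFt, smul_smul]
  congr 1
  field_simp

theorem hasDerivWithinAt_fieldF (hη : IsTimeReparam η) (n : ℕ) (x : Plane) {t : ℝ}
    (ht : t ∈ Icc (0 : ℝ) 1) :
    HasDerivWithinAt (fieldF W η c n x) (fieldFt W η c n x t) (Icc 0 1) t := by
  have h := (hasDerivWithinAt_scaled (c := c) hη W.isScaledFamily_field n x ht).fun_const_smul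
    (lam n / tau n)
  refine h.congr_deriv ?_
  rw [fieldFt, smul_smul]
  congr 1
  ring

theorem hasFDerivAt_eulerPiece (hη : IsTimeReparam η) (hc : IsCubeCentres c) {n : ℕ} (hn : 1 ≤ n)
    (x : Plane) {t : ℝ} (ht : t ∈ Icc (0 : ℝ) 1) :
    HasFDerivAt (fun y => eulerPiece W η c n y t) (gradEulerPiece W η c n x t) x :=
  (hasFDerivAt_fieldFt hη hc hn x ht).fun_add
    ((hasFDerivAt_fieldDF hη hc hn x ht).clm_apply (hasFDerivAt_fieldF hη hc hn x ht))

theorem hasFDerivAt_lapPiece (hη : IsTimeReparam η) (hc : IsCubeCentres c) {n : ℕ} (hn : 1 ≤ n)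
    (x : Plane) {t : ℝ} (ht : t ∈ Icc (0 : ℝ) 1) :
    HasFDerivAt (fun y => lapPiece W η c n y t) (gradLapPiece W η c n x t) x := by
  obtain ⟨B, hB⟩ := W.exists_isScaledFamily_fieldLap
  refine ((hasFDerivAt_scaled hη hc hB hn x ht).fun_const_smul
    (1 / (tau n * lam n))).congr_fderiv ?_
  rw [gradLapPiece, smul_smul, one_div_mul_one_div, mul_assoc, ← sq]

/-! #### Continuity -/

theorem continuous_gradEulerPiece (hη : IsTimeReparam η) (hc : IsCubeCentres c) {n : ℕ}
    (hn : 1 ≤ n) {t : ℝ} (ht : t ∈ Icc (0 : ℝ) 1) :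
    Continuous fun x => gradEulerPiece W η c n x t := by
  have h0 := W.isScaledFamily_field
  have c0 := (continuous_scaled hη hc h0 hn ht).const_smul (lam n / tau n)
  have c1 := (continuous_scaled hη hc h0.dX hn ht).const_smul (1 / tau n)
  have c2 := (continuous_scaled hη hc h0.dX.dX hn ht).const_smul (1 / (tau n * lam n))
  have c3 := (continuous_scaledDeriv hη hc h0.dX h0.dT.dX hn ht).const_smul (1 / tau n ^ 2)
  exact c3.add ((c1.clm_comp c1).add
    (((ContinuousLinearMap.flipₗᵢ ℝ Plane Plane Plane).continuous.comp c2).clm_apply c0))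

theorem continuous_gradLapPiece (hη : IsTimeReparam η) (hc : IsCubeCentres c) {n : ℕ}
    (hn : 1 ≤ n) {t : ℝ} (ht : t ∈ Icc (0 : ℝ) 1) :
    Continuous fun x => gradLapPiece W η c n x t := by
  obtain ⟨B, hB⟩ := W.exists_isScaledFamily_fieldLap
  exact (continuous_scaled hη hc hB.dX hn ht).const_smul (1 / (tau n * lam n ^ 2))

theorem continuousOn_eulerPiece (hη : IsTimeReparam η) (n : ℕ) (x : Plane) :
    ContinuousOn (eulerPiece W η c n x) (Icc 0 1) := by
  have h0 := W.isScaledFamily_field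
  have c0 := (continuousOn_scaled (c := c) hη h0 n x).const_smul (lam n / tau n)
  have c1 := (continuousOn_scaled (c := c) hη h0.dX n x).const_smul (1 / tau n)
  have c2 := (continuousOn_scaledDeriv (c := c) hη h0 h0.dT n x).const_smul (lam n / tau n ^ 2)
  exact c2.add (c1.clm_apply c0)

theorem continuousOn_gradEulerPiece (hη : IsTimeReparam η) (n : ℕ) (x : Plane) :
    ContinuousOn (gradEulerPiece W η c n x) (Icc 0 1) := by
  have h0 := W.isScaledFamily_field
  have c0 := (continuousOn_scaled (c := c) hη h0 n x).const_smul (lam n / tau n)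
  have c1 := (continuousOn_scaled (c := c) hη h0.dX n x).const_smul (1 / tau n)
  have c2 := (continuousOn_scaled (c := c) hη h0.dX.dX n x).const_smul (1 / (tau n * lam n))
  have c3 := (continuousOn_scaledDeriv (c := c) hη h0.dX h0.dT.dX n x).const_smul (1 / tau n ^ 2)
  exact c3.add ((c1.clm_comp c1).add
    (((ContinuousLinearMap.flipₗᵢ ℝ Plane Plane Plane).continuous.comp_continuousOn c2).clm_apply
      c0))

theorem continuousOn_lapPiece (hη : IsTimeReparam η) (n : ℕ) (x : Plane) :
    ContinuousOn (lapPiece W η c n x) (Icc 0 1) := by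
  obtain ⟨B, hB⟩ := W.exists_isScaledFamily_fieldLap
  exact (continuousOn_scaled hη hB n x).const_smul (1 / (tau n * lam n))

theorem continuousOn_gradLapPiece (hη : IsTimeReparam η) (n : ℕ) (x : Plane) :
    ContinuousOn (gradLapPiece W η c n x) (Icc 0 1) := by
  obtain ⟨B, hB⟩ := W.exists_isScaledFamily_fieldLap
  exact (continuousOn_scaled hη hB.dX n x).const_smul (1 / (tau n * lam n ^ 2))

/-! #### Supports -/

section Support

variable {n : ℕ} {x : Plane} {t : ℝ}

theorem fieldF_eq_zero (hη : IsTimeReparam η) (hx : fractPt x ∉ cube c n)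
    (ht : t ∈ Icc (0 : ℝ) 1) : fieldF W η c n x t = 0 := by
  rw [fieldF, scaled_eq_zero hη W.isScaledFamily_field hx ht, smul_zero]

theorem fieldDF_eq_zero (hη : IsTimeReparam η) (hx : fractPt x ∉ cube c n)
    (ht : t ∈ Icc (0 : ℝ) 1) : fieldDF W η c n x t = 0 := by
  rw [fieldDF, scaled_eq_zero hη W.isScaledFamily_field.dX hx ht, smul_zero]

theorem fieldFt_eq_zero (hη : IsTimeReparam η) (hx : fractPt x ∉ cube c n)
    (ht : t ∈ Icc (0 : ℝ) 1) : fieldFt W η c n x t = 0 := by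
  have h0 := W.isScaledFamily_field
  rw [fieldFt, scaledDeriv_eq_zero hη h0 h0.dT hx ht, smul_zero]

theorem eulerPiece_eq_zero (hη : IsTimeReparam η) (hx : fractPt x ∉ cube c n)
    (ht : t ∈ Icc (0 : ℝ) 1) : eulerPiece W η c n x t = 0 := by
  simp [eulerPiece, fieldFt_eq_zero hη hx ht, fieldF_eq_zero hη hx ht]

theorem gradEulerPiece_eq_zero (hη : IsTimeReparam η) (hx : fractPt x ∉ cube c n)
    (ht : t ∈ Icc (0 : ℝ) 1) : gradEulerPiece W η c n x t = 0 := by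
  have h0 := W.isScaledFamily_field
  simp [gradEulerPiece, fieldDF_eq_zero hη hx ht, fieldF_eq_zero hη hx ht, fieldDFt,
    scaledDeriv_eq_zero hη h0.dX h0.dT.dX hx ht]

theorem lapPiece_eq_zero (hη : IsTimeReparam η) (hx : fractPt x ∉ cube c n)
    (ht : t ∈ Icc (0 : ℝ) 1) : lapPiece W η c n x t = 0 := by
  obtain ⟨B, hB⟩ := W.exists_isScaledFamily_fieldLap
  rw [lapPiece, scaled_eq_zero hη hB hx ht, smul_zero]

theorem gradLapPiece_eq_zero (hη : IsTimeReparam η) (hx : fractPt x ∉ cube c n)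
    (ht : t ∈ Icc (0 : ℝ) 1) : gradLapPiece W η c n x t = 0 := by
  obtain ⟨B, hB⟩ := W.exists_isScaledFamily_fieldLap
  rw [gradLapPiece, scaled_eq_zero hη hB.dX hx ht, smul_zero]

end Support

/-! #### Bounds -/

/-- The exponent of 2·5^k starts at -1 and rises by one with each spatial derivative; time
derivatives and the trace leave it unchanged. -/
theorem QuasiSelfSimilarVelocity.exists_bound (W : QuasiSelfSimilarVelocity) :
    ∃ C : ℝ, 1 ≤ C ∧ ∀ k x, ∀ r ∈ Icc (0 : ℝ) 1,
      ‖W.field k (x, r)‖ ≤ C / (2 * 5 ^ k) ∧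
      ‖dX univ (W.field k) (x, r)‖ ≤ C ∧
      ‖dX univ (dX univ (W.field k)) (x, r)‖ ≤ C * (2 * 5 ^ k) ∧
      ‖W.fieldLap k (x, r)‖ ≤ C * (2 * 5 ^ k) ∧
      ‖dX univ (W.fieldLap k) (x, r)‖ ≤ C * (2 * 5 ^ k) ^ 2 ∧
      ‖dT univ (W.field k) (x, r)‖ ≤ C / (2 * 5 ^ k) ∧
      ‖dX univ (dT univ (W.field k)) (x, r)‖ ≤ C := by
  have h0 := W.isScaledFamily_field
  obtain ⟨C0, p0, b0⟩ := h0.exists_bound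
  obtain ⟨C1, p1, b1⟩ := h0.dX.exists_bound
  obtain ⟨C2, p2, b2⟩ := h0.dX.dX.exists_bound
  obtain ⟨B, hB⟩ := W.exists_isScaledFamily_fieldLap
  obtain ⟨C3, p3, b3⟩ := hB.dX.exists_bound
  obtain ⟨C6, p6, b6⟩ := hB.exists_bound
  obtain ⟨C4, p4, b4⟩ := h0.dT.exists_bound
  obtain ⟨C5, p5, b5⟩ := h0.dT.dX.exists_bound
  refine ⟨1 + C0 + C1 + C2 + C3 + C4 + C5 + C6, by linarith, fun k x r hr => ?_⟩
  have hP : (0 : ℝ) < 2 * 5 ^ k := by positivity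
  have e1 : 1 / (2 * 5 ^ k : ℝ) * (2 * 5 ^ k) = 1 := by field_simp
  have e2 : |(2 * 5 ^ k : ℝ)| = 2 * 5 ^ k := abs_of_pos hP
  have e3 : |1 / (2 * 5 ^ k : ℝ)| = 1 / (2 * 5 ^ k) := abs_of_pos (by positivity)
  replace b0 := b0 k x r hr
  replace b1 := b1 k x r hr
  replace b2 := b2 k x r hr
  replace b3 := b3 k x r hr
  replace b4 := b4 k x r hr
  replace b5 := b5 k x r hr
  replace b6 := b6 k x r hr
  simp only [e1, one_mul, abs_mul, e2, e3, abs_one, one_div_mul_eq_div] at b0 b1 b2 b3 b4 b5 b6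
  refine ⟨b0.trans ?_, b1.trans ?_, b2.trans ?_, b6.trans ?_, b3.trans ?_, b4.trans ?_, b5.trans ?_⟩
  · gcongr; linarith
  · linarith
  · rw [mul_comm]; gcongr; linarith
  · rw [mul_comm]; gcongr; linarith
  · rw [mul_comm, ← sq]; gcongr; linarith
  · gcongr; linarith
  · linarith

/-- P = 2·5^⌊t/τ_n⌋ is the frequency active at time t, shared by all the bounds. It is kept
explicit, since replacing it by its maximum would lose the cancellation between D²F and F. -/
theorem exists_field_bound (hη : IsTimeReparam η) (W : QuasiSelfSimilarVelocity)
    (c : ℕ → Plane) : ∃ C : ℝ, 1 ≤ C ∧ ∀ n x, ∀ t ∈ Icc (0 : ℝ) 1, ∃ P : ℝ, 1 ≤ P ∧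
      P ≤ 2 * 5 ^ n ^ 3 ∧
      ‖fieldF W η c n x t‖ ≤ lam n * n ^ 3 * (C / P) ∧
      ‖fieldDF W η c n x t‖ ≤ n ^ 3 * C ∧
      ‖fieldD2F W η c n x t‖ ≤ n ^ 3 / lam n * (C * P) ∧
      ‖lapPiece W η c n x t‖ ≤ n ^ 3 / lam n * (C * P) ∧
      ‖gradLapPiece W η c n x t‖ ≤ n ^ 3 / lam n ^ 2 * (C * P ^ 2) ∧
      ‖fieldFt W η c n x t‖ ≤ n ^ 6 * C ∧ ‖fieldDFt W η c n x t‖ ≤ n ^ 6 * C := by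
  obtain ⟨C, hC, hb⟩ := W.exists_bound
  obtain ⟨H, hH, he⟩ := hη.exists_bound
  have hC0 : 0 < C := by linarith
  have hH0 : 0 < H := by linarith
  have hHH : H ≤ 2 * H ^ 2 := by nlinarith
  -- As H ≥ 1, the factor 2H² absorbs both |η'| and |η''| + |η'|².
  refine ⟨2 * H ^ 2 * C, by nlinarith, fun n x t ht => ?_⟩
  have hl := lam_pos n
  have hk := floor_div_tau_le ht n
  obtain ⟨he1, he2⟩ := he _ (div_tau_nonneg ht n)
  obtain ⟨b0, b1, b2, b6, b3, b4, b5⟩ := hb ⌊t / tau n⌋₊ (zoom c n (fractPt x)) _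
    (reparam_mem_Icc hη n ht)
  have hP1 : (1 : ℝ) ≤ 2 * 5 ^ ⌊t / tau n⌋₊ := by
    have : (1 : ℝ) ≤ 5 ^ ⌊t / tau n⌋₊ := one_le_pow₀ (by norm_num)
    linarith
  have hP2 : (2 * 5 ^ ⌊t / tau n⌋₊ : ℝ) ≤ 2 * 5 ^ n ^ 3 := by gcongr; norm_num
  set P : ℝ := 2 * 5 ^ ⌊t / tau n⌋₊
  have hP0 : 0 < P := by linarith
  have c0 : lam n / tau n = lam n * n ^ 3 := by rw [← one_div_tau, mul_one_div]
  have c2 : 1 / (tau n * lam n) = n ^ 3 / lam n := by rw [← one_div_tau, div_div]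
  have c3 : 1 / (tau n * lam n ^ 2) = n ^ 3 / lam n ^ 2 := by rw [← one_div_tau, div_div]
  have c5 : 1 / tau n ^ 2 = (n : ℝ) ^ 6 := by rw [← one_div_pow, one_div_tau, ← pow_mul]
  have c4 : lam n / tau n ^ 2 = lam n * n ^ 6 := by rw [← c5, mul_one_div]
  have hs : ∀ {E : Type} [NormedAddCommGroup E] [NormedSpace ℝ E] {y : E} {D : ℝ}, 0 ≤ D →
      ‖y‖ ≤ D → ‖eta1 η (t / tau n) • y‖ ≤ 2 * H ^ 2 * D := fun hD hy => by
    rw [norm_smul, Real.norm_eq_abs]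
    exact mul_le_mul (he1.trans hHH) hy (norm_nonneg _) (by positivity)
  have hs' : ∀ {E : Type} [NormedAddCommGroup E] [NormedSpace ℝ E] {y z : E} {D : ℝ}, 0 ≤ D →
      ‖y‖ ≤ D → ‖z‖ ≤ D →
      ‖eta2 η (t / tau n) • y + eta1 η (t / tau n) ^ 2 • z‖ ≤ 2 * H ^ 2 * D := by
    intro E _ _ y z D hD hy hz
    have h1 : ‖eta2 η (t / tau n) • y‖ ≤ H ^ 2 * D := by
      rw [norm_smul, Real.norm_eq_abs]
      exact mul_le_mul (he2.trans (by nlinarith)) hy (norm_nonneg _) (by positivity)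
    have h2 : ‖eta1 η (t / tau n) ^ 2 • z‖ ≤ H ^ 2 * D := by
      rw [norm_smul, norm_pow, Real.norm_eq_abs]
      gcongr
    calc _ ≤ _ := norm_add_le _ _
      _ ≤ 2 * H ^ 2 * D := by linarith
  have hCP : C / P ≤ C := div_le_self hC0.le hP1
  refine ⟨P, hP1, hP2, ?_, ?_, ?_, ?_, ?_, ?_, ?_⟩
  · rw [fieldF, scaled_eq hη _ n x ht, c0, norm_smul, Real.norm_of_nonneg (by positivity),
      mul_div_assoc]
    gcongr
    exact hs (by positivity) b0
  · rw [fieldDF, scaled_eq hη _ n x ht, one_div_tau, norm_smul,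
      Real.norm_of_nonneg (by positivity)]
    gcongr
    exact hs hC0.le b1
  · rw [fieldD2F, scaled_eq hη _ n x ht, c2, norm_smul, Real.norm_of_nonneg (by positivity),
      mul_assoc (2 * H ^ 2)]
    gcongr
    exact hs (by positivity) b2
  · rw [lapPiece, scaled_eq hη _ n x ht, c2, norm_smul, Real.norm_of_nonneg (by positivity),
      mul_assoc (2 * H ^ 2)]
    gcongr
    exact hs (by positivity) b6
  · rw [gradLapPiece, scaled_eq hη _ n x ht, c3, norm_smul, Real.norm_of_nonneg (by positivity),
      mul_assoc (2 * H ^ 2)]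
    gcongr
    exact hs (by positivity) b3
  -- The gains λ_n and 1/P are discarded here: n⁶ is needed for the gradient anyway.
  · rw [fieldFt, scaledDeriv, glueDeriv, c4, norm_smul, Real.norm_of_nonneg (by positivity)]
    refine mul_le_mul (mul_le_of_le_one_left (by positivity) (lam_le_one n))
      (hs' hC0.le (b0.trans hCP) (b4.trans hCP)) (norm_nonneg _) (by positivity)
  · rw [fieldDFt, scaledDeriv, glueDeriv, c5, norm_smul, Real.norm_of_nonneg (by positivity)]
    gcongr
    exact hs' hC0.le b1 b5

/-- The Euler part grows only polynomially in n, whereas the viscous part is measured in units of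
1/ν_n, which is how ν_n was chosen. -/
theorem exists_piece_bound (hη : IsTimeReparam η) (W : QuasiSelfSimilarVelocity)
    (c : ℕ → Plane) : ∃ K : ℝ, 0 ≤ K ∧ ∀ n x, ∀ t ∈ Icc (0 : ℝ) 1,
      ‖fieldF W η c n x t‖ ≤ K * n ^ 6 ∧ ‖fieldDF W η c n x t‖ ≤ K * n ^ 6 ∧
      ‖eulerPiece W η c n x t‖ ≤ K * n ^ 6 ∧ ‖gradEulerPiece W η c n x t‖ ≤ K * n ^ 6 ∧
      ‖lapPiece W η c n x t‖ ≤ K / nu n ∧ ‖gradLapPiece W η c n x t‖ ≤ K / nu n := by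
  obtain ⟨C, hC, hb⟩ := exists_field_bound hη W c
  have hC0 : 0 < C := by linarith
  have hK1 : C ≤ C ^ 2 := by nlinarith
  -- The 4 comes from P² ≤ 4·25^(n³); it also covers the at most three terms of size n⁶C² in the
  -- Euler bounds.
  refine ⟨4 * C ^ 2, by positivity, fun n x t ht => ?_⟩
  obtain ⟨P, hP1, hP2, b0, b1, b2, b6, b3, b4, b5⟩ := hb n x t ht
  have hl := lam_pos n
  have hl1 := lam_le_one n
  have hP0 : 0 < P := by linarith
  have hn3 : (n : ℝ) ^ 3 ≤ n ^ 6 := by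
    have h : n ^ 3 ≤ n ^ 6 := by
      rw [show n ^ 6 = n ^ 3 * n ^ 3 by ring]
      exact Nat.le_mul_self _
    exact_mod_cast h
  have b0' : ‖fieldF W η c n x t‖ ≤ n ^ 3 * C := by
    refine b0.trans (mul_le_mul (mul_le_of_le_one_left (by positivity) hl1)
      (div_le_self hC0.le hP1) (by positivity) (by positivity))
  have hone : n ^ 3 * C ≤ n ^ 6 * C := by gcongr
  have hprod : (n : ℝ) ^ 3 * C * (n ^ 3 * C) = n ^ 6 * C ^ 2 := by ring
  have hCn : (n : ℝ) ^ 6 * C ≤ n ^ 6 * C ^ 2 := by gcongr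
  have hCn0 : 0 ≤ (n : ℝ) ^ 6 * C ^ 2 := by positivity
  have hP25 : P ^ 2 ≤ 4 * 25 ^ n ^ 3 := by
    calc P ^ 2 ≤ (2 * 5 ^ n ^ 3) ^ 2 := by gcongr
      _ = 4 * (5 ^ 2) ^ n ^ 3 := by rw [mul_pow, ← pow_mul, ← pow_mul, mul_comm 2 (n ^ 3)]; norm_num
      _ = 4 * 25 ^ n ^ 3 := by norm_num
  have hlap : n ^ 3 / lam n ^ 2 * (C * P ^ 2) ≤ 4 * C ^ 2 / nu n := by
    rw [← mul_one_div (4 * C ^ 2), one_div_nu]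
    calc n ^ 3 / lam n ^ 2 * (C * P ^ 2) ≤ n ^ 3 / lam n ^ 2 * (C ^ 2 * (4 * 25 ^ n ^ 3)) := by
          gcongr
      _ = _ := by ring
  refine ⟨by linarith, by linarith, ?_, ?_, ?_, ?_⟩
  · have h1 : ‖fieldDF W η c n x t (fieldF W η c n x t)‖ ≤ n ^ 3 * C * (n ^ 3 * C) :=
      ((fieldDF W η c n x t).le_opNorm _).trans (by gcongr)
    calc _ ≤ _ := norm_add_le _ _
      _ ≤ _ := by linarith
  · have h1 : ‖(fieldDF W η c n x t).comp (fieldDF W η c n x t)‖ ≤ n ^ 3 * C * (n ^ 3 * C) :=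
      (ContinuousLinearMap.opNorm_comp_le _ _).trans (by gcongr)
    -- The decisive cancellation: D²F grows like P/λ_n and F decays like λ_n/P.
    have h2 : ‖(fieldD2F W η c n x t).flip (fieldF W η c n x t)‖ ≤ n ^ 6 * C ^ 2 := by
      calc _ ≤ ‖(fieldD2F W η c n x t).flip‖ * ‖fieldF W η c n x t‖ :=
            ContinuousLinearMap.le_opNorm _ _
        _ ≤ n ^ 3 / lam n * (C * P) * (lam n * n ^ 3 * (C / P)) := by
            rw [ContinuousLinearMap.opNorm_flip]
            gcongr
        _ = n ^ 6 * C ^ 2 := by field_simp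
    calc _ ≤ _ := (norm_add_le _ _).trans (add_le_add_right (norm_add_le _ _) _)
      _ ≤ _ := by linarith
  -- Since λ_n ≤ 1 ≤ P, the bound for the gradient of the Laplacian also bounds the Laplacian.
  · have hl2 : lam n ^ 2 ≤ lam n := by nlinarith
    have hP3 : P ≤ P ^ 2 := by nlinarith
    refine (b6.trans ?_).trans hlap
    gcongr
  · exact b3.trans hlap

end Fields

/-! ### Dominating functions -/

section Dominating

variable {c : ℕ → Plane} {w : ℕ → ℝ}

/-- Disjointness in its working form: all terms of a sum over the cubes vanish except possibly one.
Off all the cubes the index is arbitrary, and 0 is used. -/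
theorem exists_index (hc : IsCubeCentres c) (x : Plane) :
    ∃ n, ∀ k, k ≠ n → x ∉ cube c (k + 1) := by
  by_cases h : ∃ n, x ∈ cube c (n + 1)
  · obtain ⟨n, hn⟩ := h
    refine ⟨n, fun k hk hx => ?_⟩
    exact disjoint_left.1 (hc.disjoint (k + 1) (n + 1) (by omega) (by omega) (by omega)) hx hn
  · exact ⟨0, fun k _ hx => h ⟨k, hx⟩⟩

theorem isOpen_cube (c : ℕ → Plane) (n : ℕ) : IsOpen (cube c n) := by
  have : cube c n = ⋂ i, {x : Plane | |x i - c n i| < 3 * lam n} := by ext; simp [cube]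
  rw [this]
  exact isOpen_iInter_of_finite fun i =>
    isOpen_lt ((continuous_coord i).sub continuous_const).abs continuous_const

/-- The cube lies in the ball of radius 6λ_n, as 3√2 < 6. Only the order λ_n² matters. -/
theorem volume_cube_le (c : ℕ → Plane) (n : ℕ) :
    volume (cube c n) ≤ ENNReal.ofReal ((6 * lam n) ^ 2) * volume (Metric.ball (0 : Plane) 1) := by
  have hl := lam_pos n
  have h := Measure.addHaar_ball (volume : Measure Plane) (c n) (r := 6 * lam n) (by positivity)
  rw [finrank_euclideanSpace_fin] at h
  rw [← h]
  refine measure_mono fun x hx => ?_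
  rw [mem_ball_iff_norm, EuclideanSpace.norm_eq]
  refine (Real.sqrt_lt' (by positivity)).2 ?_
  have h0 := sq_lt_sq' (by linarith [abs_nonneg (x 0 - c n 0)]) (hx 0)
  have h1 := sq_lt_sq' (by linarith [abs_nonneg (x 1 - c n 1)]) (hx 1)
  simp only [sq_abs] at h0 h1
  simp only [Fin.sum_univ_two, Real.norm_eq_abs, sq_abs, PiLp.sub_apply]
  nlinarith [sq_nonneg (lam n)]

/-- The function equal to `w n` on the cube with index `n ≥ 1`, and to `0` off the cubes. -/
noncomputable def dom (c : ℕ → Plane) (w : ℕ → ℝ) (x : Plane) : ℝ :=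
  ∑' n, (cube c (n + 1)).indicator (fun _ => w (n + 1)) x

theorem dom_eq {x : Plane} {n : ℕ} (h : ∀ k, k ≠ n → x ∉ cube c (k + 1)) (w : ℕ → ℝ) :
    dom c w x = (cube c (n + 1)).indicator (fun _ => w (n + 1)) x :=
  tsum_eq_single n fun k hk => indicator_of_notMem (h k hk) _

theorem dom_eq_zero (hc : IsCubeCentres c) (w : ℕ → ℝ) {x : Plane} (hx : x ∉ innerSquare) :
    dom c w x = 0 := by
  have h : ∀ k, x ∉ cube c (k + 1) := fun k hk => hx fun i => hc.inside _ (by omega) x hk i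
  rw [dom_eq (n := 0) (fun k _ => h k), indicator_of_notMem (h 0)]

theorem measurable_dom (hc : IsCubeCentres c) (w : ℕ → ℝ) : Measurable (dom c w) := by
  refine measurable_of_tendsto_metrizable (f := fun m x => ∑ n ∈ Finset.range m,
    (cube c (n + 1)).indicator (fun _ => w (n + 1)) x) (fun m => ?_) ?_
  · exact Finset.measurable_fun_sum _ fun n _ =>
      measurable_const.indicator (isOpen_cube c (n + 1)).measurableSet
  · refine tendsto_pi_nhds.2 fun x => ?_
    obtain ⟨n, hn⟩ := exists_index hc x
    have h : HasSum (fun k => (cube c (k + 1)).indicator (fun _ => w (k + 1)) x)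
        ((cube c (n + 1)).indicator (fun _ => w (n + 1)) x) :=
      hasSum_single n fun k hk => indicator_of_notMem (hn k hk) _
    rw [dom_eq hn]
    exact h.tendsto_sum_nat

/-- The factor e^(-2n) beats any power of n; the real exponent q is first raised to a natural number
N. -/
theorem summable_weight (K : ℝ) (hK : 0 ≤ K) (q : ℝ) :
    Summable fun n : ℕ => (K * ((n + 1 : ℕ) : ℝ) ^ 6) ^ q * (6 * lam (n + 1)) ^ 2 := by
  obtain ⟨N, hN⟩ := exists_nat_ge q
  have h := (Real.summable_pow_mul_exp_neg_nat_mul (6 * N) (r := 2) two_pos).mul_left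
    (K ^ q * (36 / 10000))
  refine Summable.of_nonneg_of_le (fun n => by positivity) (fun n => ?_)
    ((summable_nat_add_iff 1).2 h)
  have h1 : (1 : ℝ) ≤ ((n + 1 : ℕ) : ℝ) ^ 6 := 
    one_le_pow₀ (by push_cast; linarith [n.cast_nonneg (α := ℝ)])
  have h2 : (((n + 1 : ℕ) : ℝ) ^ 6) ^ q ≤ ((n + 1 : ℕ) : ℝ) ^ (6 * N) := by
    rw [pow_mul, ← Real.rpow_natCast (((n + 1 : ℕ) : ℝ) ^ 6)]
    exact Real.rpow_le_rpow_of_exponent_le h1 hN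
  have h3 : (6 * lam (n + 1)) ^ 2 = 36 / 10000 * Real.exp (-2 * ((n + 1 : ℕ) : ℝ)) := by
    have : Real.exp (-2 * ((n + 1 : ℕ) : ℝ)) = Real.exp (-((n + 1 : ℕ) : ℝ)) ^ 2 := by
      rw [← Real.exp_nat_mul]
      congr 1
      push_cast
      ring
    rw [this, lam]
    ring
  rw [Real.mul_rpow hK (by positivity), h3]
  calc K ^ q * (((n + 1 : ℕ) : ℝ) ^ 6) ^ q * (36 / 10000 * Real.exp (-2 * ((n + 1 : ℕ) : ℝ)))
      ≤ K ^ q * ((n + 1 : ℕ) : ℝ) ^ (6 * N) * (36 / 10000 * Real.exp (-2 * ((n + 1 : ℕ) : ℝ))) := by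
        gcongr
    _ = _ := by ring

/-- This is where p < ∞ enters: the values n⁶ are unbounded, but their p-th powers are summable
against the areas. -/
theorem memLp_dom (hc : IsCubeCentres c) {K : ℝ} (hK : 0 ≤ K) {p : ℝ≥0∞} (hp0 : p ≠ 0)
    (hp : p ≠ ⊤) : MemLp (dom c fun n => K * n ^ 6) p volume := by
  set w : ℕ → ℝ := fun n => K * n ^ 6
  have hw : ∀ n, 0 ≤ w n := fun n => by positivity
  have hq : 0 < p.toReal := ENNReal.toReal_pos hp0 hp
  refine ⟨(measurable_dom hc w).aestronglyMeasurable, ?_⟩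
  rw [eLpNorm_lt_top_iff_lintegral_rpow_enorm_lt_top hp0 hp]
  have hle : ∀ x, ‖dom c w x‖ₑ ^ p.toReal ≤ ∑' n, (cube c (n + 1)).indicator
      (fun _ => ENNReal.ofReal (w (n + 1) ^ p.toReal)) x := fun x => by
    obtain ⟨n, hn⟩ := exists_index hc x
    refine le_trans ?_ (ENNReal.le_tsum n)
    rw [dom_eq hn]
    by_cases hx : x ∈ cube c (n + 1)
    · rw [indicator_of_mem hx, indicator_of_mem hx, Real.enorm_of_nonneg (hw _),
        ENNReal.ofReal_rpow_of_nonneg (hw _) hq.le]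
    · rw [indicator_of_notMem hx, indicator_of_notMem hx, enorm_zero, ENNReal.zero_rpow_of_pos hq]
  refine (lintegral_mono hle).trans_lt ?_
  rw [lintegral_tsum fun n =>
    (measurable_const.indicator (isOpen_cube c (n + 1)).measurableSet).aemeasurable]
  have hterm : ∀ n, ∫⁻ x, (cube c (n + 1)).indicator
      (fun _ => ENNReal.ofReal (w (n + 1) ^ p.toReal)) x ≤
      ENNReal.ofReal (w (n + 1) ^ p.toReal * (6 * lam (n + 1)) ^ 2) *
        volume (Metric.ball (0 : Plane) 1) := fun n => by
    rw [lintegral_indicator_const (isOpen_cube c (n + 1)).measurableSet,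
      ENNReal.ofReal_mul (by positivity), mul_assoc]
    gcongr
    exact volume_cube_le c (n + 1)
  refine (ENNReal.tsum_le_tsum hterm).trans_lt ?_
  rw [ENNReal.tsum_mul_right]
  exact ENNReal.mul_lt_top (summable_weight K hK p.toReal).tsum_ofReal_lt_top
    Metric.isBounded_ball.measure_lt_top

/-- The periodic extension of `dom`. -/
noncomputable def domP (c : ℕ → Plane) (w : ℕ → ℝ) (x : Plane) : ℝ := dom c w (fractPt x)

theorem measurableSet_unitCell : MeasurableSet unitCell := by
  have : unitCell = ⋂ i, {x : Plane | x i ∈ Ico (0 : ℝ) 1} := by ext; simp [unitCell]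
  rw [this]
  exact MeasurableSet.iInter fun i => measurableSet_Ico.preimage (continuous_coord i).measurable

theorem fractPt_eq_self {x : Plane} (hx : x ∈ unitCell) : fractPt x = x := by
  ext i
  exact Int.fract_eq_self.2 (hx i)

theorem domP_ae_eq (c : ℕ → Plane) (w : ℕ → ℝ) :
    domP c w =ᵐ[volume.restrict unitCell] dom c w := by
  filter_upwards [ae_restrict_mem measurableSet_unitCell] with x hx
  rw [domP, fractPt_eq_self hx]

theorem aestronglyMeasurable_domP (hc : IsCubeCentres c) (w : ℕ → ℝ) :
    AEStronglyMeasurable (domP c w) (volume.restrict unitCell) :=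
  (measurable_dom hc w).aestronglyMeasurable.congr (domP_ae_eq c w).symm

theorem memLp_domP (hc : IsCubeCentres c) {K : ℝ} (hK : 0 ≤ K) {p : ℝ≥0∞} (hp0 : p ≠ 0)
    (hp : p ≠ ⊤) : MemLp (domP c fun n => K * n ^ 6) p (volume.restrict unitCell) :=
  ((memLp_dom hc hK hp0 hp).restrict _).ae_eq (domP_ae_eq c _).symm

/-- Near each point the periodic extension is a translate of `dom`, which is integrable on the
plane. -/
theorem locallyIntegrable_domP (hc : IsCubeCentres c) {K : ℝ} (hK : 0 ≤ K) :
    LocallyIntegrable (domP c fun n => K * n ^ 6) volume := by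
  intro x
  have h1 : Integrable (dom c fun n => K * n ^ 6) volume :=
    memLp_one_iff_integrable.1 (memLp_dom hc hK one_ne_zero ENNReal.one_ne_top)
  obtain ⟨s, hs, hso, hxs⟩ := mem_nhds_iff.1
    (comp_fractPt_eventuallyEq (fun y hy => dom_eq_zero hc (fun n => K * n ^ 6) hy) x)
  refine ⟨s, hso.mem_nhds hxs, ?_⟩
  exact ((h1.comp_sub_right (x - fractPt x)).integrableOn (s := s)).congr_fun
    (fun y hy => (hs hy).symm) hso.measurableSet

theorem norm_le_domP {E : Type*} [NormedAddCommGroup E] {x : Plane} {n : ℕ}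
    (h : ∀ k, k ≠ n → fractPt x ∉ cube c (k + 1)) {y : E} (hy : ‖y‖ ≤ w (n + 1))
    (h0 : fractPt x ∉ cube c (n + 1) → y = 0) : ‖y‖ ≤ domP c w x := by
  rw [domP, dom_eq h]
  by_cases hx : fractPt x ∈ cube c (n + 1)
  · rwa [indicator_of_mem hx]
  · rw [indicator_of_notMem hx, h0 hx, norm_zero]

end Dominating

/-! ### Sums of functions supported in the cubes -/

section Sums

variable {E : Type*} [NormedAddCommGroup E] {c : ℕ → Plane}

theorem sum_Icc_eq_ite {f : ℕ → E} {n : ℕ} (h : ∀ k, k ≠ n → f (k + 1) = 0) (m : ℕ) :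
    ∑ k ∈ Finset.Icc 1 m, f k = if n + 1 ≤ m then f (n + 1) else 0 := by
  split_ifs with hm
  · refine Finset.sum_eq_single (n + 1) (fun k hk hkn => ?_) fun hn => ?_
    · obtain ⟨j, rfl⟩ := Nat.exists_eq_add_of_le' (Finset.mem_Icc.1 hk).1
      exact h j (by omega)
    · exact absurd (Finset.mem_Icc.2 ⟨by omega, hm⟩) hn
  · refine Finset.sum_eq_zero fun k hk => ?_
    obtain ⟨h1, h2⟩ := Finset.mem_Icc.1 hk
    obtain ⟨j, rfl⟩ := Nat.exists_eq_add_of_le' h1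
    exact h j (by omega)

theorem tendsto_sum_Icc {f : ℕ → E} {n : ℕ} (h : ∀ k, k ≠ n → f (k + 1) = 0) :
    Tendsto (fun m => ∑ k ∈ Finset.Icc 1 m, f k) atTop (𝓝 (∑' k, f (k + 1))) := by
  rw [tsum_eq_single n h]
  refine tendsto_const_nhds.congr' ?_
  filter_upwards [eventually_ge_atTop (n + 1)] with m hm
  rw [sum_Icc_eq_ite h, if_pos hm]

/-- An infinite sum of `C¹` functions supported in the cubes has the sum of the gradients as its
weak gradient. -/
theorem isWeakGradient_tsum (hc : IsCubeCentres c) {f : ℕ → Plane → Plane}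
    {G : ℕ → Plane → Plane →L[ℝ] Plane} {K : ℝ} (hK : 0 ≤ K)
    (hf0 : ∀ n x, fractPt x ∉ cube c n → f n x = 0)
    (hG0 : ∀ n x, fractPt x ∉ cube c n → G n x = 0)
    (hf : ∀ n, 1 ≤ n → ∀ x, HasFDerivAt (f n) (G n x) x)
    (hG : ∀ n, 1 ≤ n → Continuous (G n))
    (hfK : ∀ n x, ‖f n x‖ ≤ K * n ^ 6) (hGK : ∀ n x, ‖G n x‖ ≤ K * n ^ 6) :
    IsWeakGradient (fun x => ∑' n, f (n + 1) x) (fun x => ∑' n, G (n + 1) x) := by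
  have hbound : ∀ {F : Type} [NormedAddCommGroup F] (u : ℕ → Plane → F),
      (∀ n x, fractPt x ∉ cube c n → u n x = 0) → (∀ n x, ‖u n x‖ ≤ K * n ^ 6) → ∀ m x,
      ‖∑ n ∈ Finset.Icc 1 m, u n x‖ ≤ domP c (fun n => K * n ^ 6) x := by
    intro F _ u hu0 huK m x
    obtain ⟨n, hn⟩ := exists_index hc (fractPt x)
    rw [sum_Icc_eq_ite (fun k hk => hu0 _ _ (hn k hk))]
    refine norm_le_domP hn ?_ fun hx => ?_
    · split_ifs
      · exact huK _ _
      · rw [norm_zero]; positivity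
    · simp [hu0 _ _ hx]
  -- Partial sums are C¹, eventually constant at each point, and dominated by the same locally
  -- integrable function.
  refine IsWeakGradient.of_tendsto (f := fun m x => ∑ n ∈ Finset.Icc 1 m, f n x)
    (G := fun m x => ∑ n ∈ Finset.Icc 1 m, G n x) (fun m => ?_) (locallyIntegrable_domP hc hK)
    (hbound f hf0 hfK) (hbound G hG0 hGK) (fun x => ?_) fun x => ?_
  · exact isWeakGradient_of_hasFDerivAt
      (fun x => HasFDerivAt.fun_sum fun n hn => hf n (Finset.mem_Icc.1 hn).1 x)
      (continuous_finsetSum _ fun n hn => hG n (Finset.mem_Icc.1 hn).1)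
  · obtain ⟨n, hn⟩ := exists_index hc (fractPt x)
    exact tendsto_sum_Icc fun k hk => hf0 _ _ (hn k hk)
  · obtain ⟨n, hn⟩ := exists_index hc (fractPt x)
    exact tendsto_sum_Icc fun k hk => hG0 _ _ (hn k hk)

end Sums

/-! ### The body forces -/

section Assembly

theorem laplacian_eq_bilinTrace {f : Plane → Plane} {f' : Plane → Plane →L[ℝ] Plane} {x : Plane}
    {f'' : Plane →L[ℝ] Plane →L[ℝ] Plane} (hf : ∀ y, HasFDerivAt f (f' y) y)
    (hf' : HasFDerivAt f' f'' x) : Laplacian.laplacian f x = bilinTrace f'' := by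
  have h1 : fderiv ℝ f = f' := funext fun y => (hf y).fderiv
  have h2 := congrFun (InnerProductSpace.laplacian_eq_iteratedFDeriv_orthonormalBasis f
    (EuclideanSpace.basisFun (Fin 2) ℝ)) x
  rw [h2]
  simp [iteratedFDeriv_two_apply, h1, hf'.fderiv, bilinTrace]

theorem nu_pos {n : ℕ} (hn : 1 ≤ n) : 0 < nu n := by
  have h1 : 0 < tau n := by
    have : (0 : ℝ) < n := by exact_mod_cast hn
    unfold tau
    positivity
  have h2 := lam_pos n
  rw [nu_eq]
  positivity

theorem nu_anti {n m : ℕ} (hn : 1 ≤ n) (hnm : n ≤ m) : nu m ≤ nu n := by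
  have hn' : (0 : ℝ) < n := by exact_mod_cast hn
  have hnm' : (n : ℝ) ≤ m := by exact_mod_cast hnm
  have h1 : lam m ≤ lam n := by unfold lam; gcongr
  have h2 : tau m ≤ tau n := by unfold tau; gcongr
  have h3 : ((25 : ℝ) ^ m ^ 3)⁻¹ ≤ ((25 : ℝ) ^ n ^ 3)⁻¹ := by
    gcongr
    norm_num
  have h4 := lam_pos m
  have h5 := tau_nonneg m
  have h6 := tau_nonneg n
  rw [nu_eq, nu_eq]
  gcongr

theorem tendsto_nu : Tendsto nu atTop (𝓝 0) := by
  have h1 : Tendsto lam atTop (𝓝 0) := by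
    have := (Real.tendsto_exp_neg_atTop_nhds_zero.comp
      (tendsto_natCast_atTop_atTop (R := ℝ))).const_mul (1 / 100)
    rw [mul_zero] at this
    exact this
  refine squeeze_zero' (eventually_ge_atTop 1 |>.mono fun n hn => (nu_pos hn).le)
    (eventually_ge_atTop 1 |>.mono fun n hn => ?_) h1
  have hl := lam_pos n
  have hl1 := lam_le_one n
  have ht : tau n ≤ 1 := by
    have : (1 : ℝ) ≤ (n : ℝ) ^ 3 := one_le_pow₀ (by exact_mod_cast hn)
    exact div_le_one_of_le₀ this (by positivity)
  have ht0 := tau_nonneg n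
  have h25 : ((25 : ℝ) ^ n ^ 3)⁻¹ ≤ 1 := inv_le_one_of_one_le₀ (one_le_pow₀ (by norm_num))
  have h250 : 0 ≤ ((25 : ℝ) ^ n ^ 3)⁻¹ := by positivity
  rw [nu_eq]
  calc lam n ^ 2 * tau n * ((25 : ℝ) ^ n ^ 3)⁻¹ ≤ lam n ^ 2 * 1 * 1 := by gcongr
    _ ≤ lam n := by nlinarith

variable {W : QuasiSelfSimilarVelocity} {η : ℝ → ℝ} {c : ℕ → Plane}

/-- Definitional: `periodize` only inserts `fractPt x`, and `baseVel` unfolds to `glue`. -/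
theorem truncVel_eq (W : QuasiSelfSimilarVelocity) (η : ℝ → ℝ) (c : ℕ → Plane) (m : ℕ) (x : Plane)
    (t : ℝ) : truncVel W η c m x t = ∑ n ∈ Finset.Icc 1 m, fieldF W η c n x t := rfl

theorem limitVel_eq (W : QuasiSelfSimilarVelocity) (η : ℝ → ℝ) (c : ℕ → Plane) (x : Plane)
    (t : ℝ) : limitVel W η c x t = ∑' n, fieldF W η c (n + 1) x t := rfl

/-- The linear terms split over the cubes by additivity; the quadratic term splits because different
pieces are never nonzero at the same point. -/
theorem force_eq (hη : IsTimeReparam η) (hc : IsCubeCentres c) (m : ℕ) (x : Plane) {t : ℝ}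
    (ht : t ∈ Icc (0 : ℝ) 1) : force W η c m x t =
      ∑ n ∈ Finset.Icc 1 m, eulerPiece W η c n x t
        - nu m • ∑ n ∈ Finset.Icc 1 m, lapPiece W η c n x t := by
  have h1 : ∀ n ∈ Finset.Icc 1 m, 1 ≤ n := fun n hn => (Finset.mem_Icc.1 hn).1
  have hF : ∀ y, HasFDerivAt (fun y => truncVel W η c m y t)
      (∑ n ∈ Finset.Icc 1 m, fieldDF W η c n y t) y := fun y =>
    HasFDerivAt.fun_sum fun n hn => hasFDerivAt_fieldF hη hc (h1 n hn) y ht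
  have hDF : HasFDerivAt (fun y => ∑ n ∈ Finset.Icc 1 m, fieldDF W η c n y t)
      (∑ n ∈ Finset.Icc 1 m, fieldD2F W η c n x t) x :=
    HasFDerivAt.fun_sum fun n hn => hasFDerivAt_fieldDF hη hc (h1 n hn) x ht
  have hFt : HasDerivWithinAt (fun s => truncVel W η c m x s)
      (∑ n ∈ Finset.Icc 1 m, fieldFt W η c n x t) (Icc 0 1) t := by
    simp only [truncVel_eq]
    exact HasDerivWithinAt.fun_sum fun n _ => hasDerivWithinAt_fieldF hη n x ht
  rw [force, nsForce, hFt.derivWithin (uniqueDiffOn_Icc zero_lt_one t ht), (hF x).fderiv,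
    laplacian_eq_bilinTrace hF hDF, map_sum, truncVel_eq]
  simp only [lapPiece_eq hη _ x ht]
  congr 1
  obtain ⟨n, hn⟩ := exists_index hc (fractPt x)
  rw [sum_Icc_eq_ite (f := fun n => fieldFt W η c n x t)
      fun k hk => fieldFt_eq_zero hη (hn k hk) ht,
    sum_Icc_eq_ite (f := fun n => fieldF W η c n x t)
      fun k hk => fieldF_eq_zero hη (hn k hk) ht,
    sum_Icc_eq_ite (f := fun n => fieldDF W η c n x t)
      fun k hk => fieldDF_eq_zero hη (hn k hk) ht,
    sum_Icc_eq_ite (f := fun n => eulerPiece W η c n x t)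
      fun k hk => eulerPiece_eq_zero hη (hn k hk) ht]
  split_ifs
  · rfl
  · simp

variable (W η c) in
/-- The gradient of the force `force W η c m`. -/
noncomputable def gradForce (m : ℕ) (x : Plane) (t : ℝ) : Plane →L[ℝ] Plane :=
  ∑ n ∈ Finset.Icc 1 m, gradEulerPiece W η c n x t
    - nu m • ∑ n ∈ Finset.Icc 1 m, gradLapPiece W η c n x t

variable (W η c) in
/-- The body force of the limit velocity. -/
noncomputable def limitForce (x : Plane) (t : ℝ) : Plane :=
  ∑' n, eulerPiece W η c (n + 1) x t

variable (W η c) in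
/-- The weak gradient of `limitForce`. -/
noncomputable def gradLimitForce (x : Plane) (t : ℝ) : Plane →L[ℝ] Plane :=
  ∑' n, gradEulerPiece W η c (n + 1) x t

theorem isWeakGradient_force (hη : IsTimeReparam η) (hc : IsCubeCentres c) (m : ℕ) {t : ℝ}
    (ht : t ∈ Icc (0 : ℝ) 1) :
    IsWeakGradient (fun x => force W η c m x t) (fun x => gradForce W η c m x t) := by
  have h1 : ∀ n ∈ Finset.Icc 1 m, 1 ≤ n := fun n hn => (Finset.mem_Icc.1 hn).1
  simp only [force_eq hη hc m _ ht]
  refine isWeakGradient_of_hasFDerivAt (fun x => ?_) ?_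
  · exact (HasFDerivAt.fun_sum fun n hn => hasFDerivAt_eulerPiece hη hc (h1 n hn) x ht).fun_sub
      ((HasFDerivAt.fun_sum fun n hn =>
        hasFDerivAt_lapPiece hη hc (h1 n hn) x ht).fun_const_smul _)
  · exact (continuous_finsetSum _ fun n hn => continuous_gradEulerPiece hη hc (h1 n hn) ht).sub
      ((continuous_finsetSum _ fun n hn =>
        continuous_gradLapPiece hη hc (h1 n hn) ht).const_smul (nu m))

theorem isPeriodic_of_comp_fractPt {f : Plane → Plane}
    (h : ∀ x y, fractPt x = fractPt y → f x = f y) :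
    IsPeriodic f := fun x k => h _ _ (fractPt_add_int x k)

theorem eulerPiece_congr {x y : Plane} (h : fractPt x = fractPt y) (n : ℕ) (t : ℝ) :
    eulerPiece W η c n x t = eulerPiece W η c n y t := by
  simp only [eulerPiece, fieldFt, fieldDF, fieldF, scaled, scaledDeriv, h]

theorem lapPiece_congr {x y : Plane} (h : fractPt x = fractPt y) (n : ℕ) (t : ℝ) :
    lapPiece W η c n x t = lapPiece W η c n y t := by
  simp only [lapPiece, scaled, h]

theorem isPeriodic_force (hη : IsTimeReparam η) (hc : IsCubeCentres c) (m : ℕ) {t : ℝ}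
    (ht : t ∈ Icc (0 : ℝ) 1) : IsPeriodic fun x => force W η c m x t :=
  isPeriodic_of_comp_fractPt fun x y h => by
    simp only [force_eq hη hc m _ ht, eulerPiece_congr h, lapPiece_congr h]

theorem isPeriodic_limitForce (t : ℝ) : IsPeriodic fun x => limitForce W η c x t :=
  isPeriodic_of_comp_fractPt fun x y h => by simp only [limitForce, eulerPiece_congr h]

theorem continuousOn_force (hη : IsTimeReparam η) (hc : IsCubeCentres c) (m : ℕ) (x : Plane) :
    ContinuousOn (force W η c m x) (Icc 0 1) :=
  ((continuousOn_finsetSum _ fun n _ => continuousOn_eulerPiece hη n x).sub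
    ((continuousOn_finsetSum _ fun n _ => continuousOn_lapPiece hη n x).const_smul (nu m))).congr
    fun _ ht => force_eq hη hc m x ht

theorem continuousOn_gradForce (hη : IsTimeReparam η) (m : ℕ) (x : Plane) :
    ContinuousOn (gradForce W η c m x) (Icc 0 1) :=
  (continuousOn_finsetSum _ fun n _ => continuousOn_gradEulerPiece hη n x).sub
    ((continuousOn_finsetSum _ fun n _ => continuousOn_gradLapPiece hη n x).const_smul (nu m))

theorem continuousOn_limitForce (hη : IsTimeReparam η) (hc : IsCubeCentres c) (x : Plane) :
    ContinuousOn (limitForce W η c x) (Icc 0 1) := by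
  obtain ⟨n, hn⟩ := exists_index hc (fractPt x)
  exact (continuousOn_eulerPiece hη (n + 1) x).congr fun t ht =>
    tsum_eq_single n fun k hk => eulerPiece_eq_zero hη (hn k hk) ht

theorem continuousOn_gradLimitForce (hη : IsTimeReparam η) (hc : IsCubeCentres c) (x : Plane) :
    ContinuousOn (gradLimitForce W η c x) (Icc 0 1) := by
  obtain ⟨n, hn⟩ := exists_index hc (fractPt x)
  exact (continuousOn_gradEulerPiece hη (n + 1) x).congr fun t ht =>
    tsum_eq_single n fun k hk => gradEulerPiece_eq_zero hη (hn k hk) ht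

/-- The cubes are fixed in time, so at each x the whole time path is that of one piece and is
differentiable on all of [0,1]. In space the cubes may accumulate, so the gradient is taken in the
weak sense. -/
theorem isEulerForce_limitForce (hη : IsTimeReparam η) (hc : IsCubeCentres c) :
    IsEulerForce (limitVel W η c) (limitForce W η c) := by
  obtain ⟨K, hK, hb⟩ := exists_piece_bound hη W c
  refine ⟨fun x t => ∑' n, fieldFt W η c (n + 1) x t, fun t x => ∑' n, fieldDF W η c (n + 1) x t,
    fun x t ht => ?_, fun t ht => ?_, fun t ht x => ?_⟩
  · obtain ⟨n, hn⟩ := exists_index hc (fractPt x)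
    have hs : ∀ s ∈ Icc (0 : ℝ) 1, limitVel W η c x s = fieldF W η c (n + 1) x s := fun s hs =>
      tsum_eq_single n fun k hk => fieldF_eq_zero hη (hn k hk) hs
    beta_reduce
    rw [tsum_eq_single n fun k hk => fieldFt_eq_zero hη (hn k hk) ht]
    exact (hasDerivWithinAt_fieldF hη (n + 1) x ht).congr hs (hs t ht)
  · exact isWeakGradient_tsum hc hK (fun n x hx => fieldF_eq_zero hη hx ht)
      (fun n x hx => fieldDF_eq_zero hη hx ht) (fun n hn x => hasFDerivAt_fieldF hη hc hn x ht)
      (fun n hn => continuous_iff_continuousAt.2 fun x =>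
        (hasFDerivAt_fieldDF hη hc hn x ht).continuousAt)
      (fun n x => (hb n x t ht).1) (fun n x => (hb n x t ht).2.1)
  · obtain ⟨n, hn⟩ := exists_index hc (fractPt x)
    beta_reduce
    rw [limitForce, limitVel_eq, tsum_eq_single n fun k hk => fieldFt_eq_zero hη (hn k hk) ht,
      tsum_eq_single n fun k hk => fieldF_eq_zero hη (hn k hk) ht,
      tsum_eq_single n fun k hk => fieldDF_eq_zero hη (hn k hk) ht,
      tsum_eq_single n fun k hk => eulerPiece_eq_zero hη (hn k hk) ht]
    rfl

theorem isWeakGradient_limitForce (hη : IsTimeReparam η) (hc : IsCubeCentres c) {t : ℝ}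
    (ht : t ∈ Icc (0 : ℝ) 1) :
    IsWeakGradient (fun x => limitForce W η c x t) (fun x => gradLimitForce W η c x t) := by
  obtain ⟨K, hK, hb⟩ := exists_piece_bound hη W c
  exact isWeakGradient_tsum hc hK (fun n x hx => eulerPiece_eq_zero hη hx ht)
    (fun n x hx => gradEulerPiece_eq_zero hη hx ht)
    (fun n hn x => hasFDerivAt_eulerPiece hη hc hn x ht)
    (fun n hn => continuous_gradEulerPiece hη hc hn ht)
    (fun n x => (hb n x t ht).2.2.1) (fun n x => (hb n x t ht).2.2.2.1)

/-! ### Majorants for the forces and for their distance to the limit -/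

section PointwiseBounds

variable {E : Type*} [NormedAddCommGroup E] [NormedSpace ℝ E] {a b : ℕ → Plane → E} {K : ℝ}

/-- The weight that controls the difference of the `m`-th force and the limit force. -/
noncomputable def tailWeight (K : ℝ) (m n : ℕ) : ℝ :=
  if n ≤ m then nu m * (K / nu n) else K * n ^ 6

/-- Monotonicity of ν gives ν_m/ν_n ≤ 1 for n ≤ m. At n = m the weight is K, so smallness is not
uniform in n and convergence must come from domination. -/
theorem tailWeight_le (hK : 0 ≤ K) {n : ℕ} (hn : 1 ≤ n) (m : ℕ) :
    0 ≤ tailWeight K m n ∧ tailWeight K m n ≤ K * n ^ 6 := by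
  have h1 : (1 : ℝ) ≤ (n : ℝ) ^ 6 := one_le_pow₀ (by exact_mod_cast hn)
  have h2 := nu_pos hn
  unfold tailWeight
  split_ifs with hnm
  · have h3 := nu_pos (hn.trans hnm)
    refine ⟨by positivity, ?_⟩
    calc nu m * (K / nu n) ≤ nu n * (K / nu n) := by gcongr; exact nu_anti hn hnm
      _ = K * 1 := by field_simp
      _ ≤ K * n ^ 6 := by gcongr
  · exact ⟨by positivity, le_rfl⟩

theorem tendsto_tailWeight (K : ℝ) (n : ℕ) :
    Tendsto (fun m => tailWeight K m n) atTop (𝓝 0) := by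
  have h := tendsto_nu.mul_const (K / nu n)
  rw [zero_mul] at h
  refine h.congr' ?_
  filter_upwards [eventually_ge_atTop n] with m hm
  rw [tailWeight, if_pos hm]

/-- One K for the Euler part and one for the viscous part. Abstract a and b serve the force and its
gradient alike. -/
theorem norm_sum_sub_le (hc : IsCubeCentres c) (hK : 0 ≤ K)
    (ha0 : ∀ n x, fractPt x ∉ cube c n → a n x = 0)
    (hb0 : ∀ n x, fractPt x ∉ cube c n → b n x = 0)
    (haK : ∀ n x, ‖a n x‖ ≤ K * n ^ 6) (hbK : ∀ n x, ‖b n x‖ ≤ K / nu n) (m : ℕ) (x : Plane) :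
    ‖∑ n ∈ Finset.Icc 1 m, a n x - nu m • ∑ n ∈ Finset.Icc 1 m, b n x‖
      ≤ domP c (fun n => 2 * K * n ^ 6) x := by
  obtain ⟨n, hn⟩ := exists_index hc (fractPt x)
  rw [sum_Icc_eq_ite (fun k hk => ha0 _ _ (hn k hk)),
    sum_Icc_eq_ite (fun k hk => hb0 _ _ (hn k hk))]
  refine norm_le_domP hn ?_ fun hx => by simp [ha0 _ _ hx, hb0 _ _ hx]
  split_ifs with hm
  · have h1 : ‖nu m • b (n + 1) x‖ ≤ K * (n + 1 : ℕ) ^ 6 := by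
      have h2 := (tailWeight_le hK (n := n + 1) (by omega) m).2
      rw [tailWeight, if_pos hm] at h2
      have h3 := nu_pos (n := m) (by omega)
      rw [norm_smul, Real.norm_of_nonneg h3.le]
      exact (mul_le_mul_of_nonneg_left (hbK _ _) h3.le).trans h2
    linarith [norm_sub_le (a (n + 1) x) (nu m • b (n + 1) x), haK (n + 1) x]
  · simp only [smul_zero, sub_zero, norm_zero]
    positivity

theorem norm_tsum_le {F : Type*} [NormedAddCommGroup F] {a : ℕ → Plane → F}
    (hc : IsCubeCentres c) (hK : 0 ≤ K) (ha0 : ∀ n x, fractPt x ∉ cube c n → a n x = 0)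
    (haK : ∀ n x, ‖a n x‖ ≤ K * n ^ 6) (x : Plane) :
    ‖∑' n, a (n + 1) x‖ ≤ domP c (fun n => 2 * K * n ^ 6) x := by
  obtain ⟨n, hn⟩ := exists_index hc (fractPt x)
  rw [tsum_eq_single n fun k hk => ha0 _ _ (hn k hk)]
  refine norm_le_domP hn ((haK _ _).trans ?_) fun hx => ha0 _ _ hx
  gcongr
  linarith

/-- On cubes with n ≤ m the Euler pieces cancel and only the viscous term is left; for n > m only
the omitted Euler piece is left. -/
theorem norm_sum_sub_tsum_le (hc : IsCubeCentres c)
    (ha0 : ∀ n x, fractPt x ∉ cube c n → a n x = 0)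
    (hb0 : ∀ n x, fractPt x ∉ cube c n → b n x = 0)
    (haK : ∀ n x, ‖a n x‖ ≤ K * n ^ 6) (hbK : ∀ n x, ‖b n x‖ ≤ K / nu n) (m : ℕ) (x : Plane) :
    ‖(∑ n ∈ Finset.Icc 1 m, a n x - nu m • ∑ n ∈ Finset.Icc 1 m, b n x) - ∑' n, a (n + 1) x‖
      ≤ domP c (tailWeight K m) x := by
  obtain ⟨n, hn⟩ := exists_index hc (fractPt x)
  rw [sum_Icc_eq_ite (fun k hk => ha0 _ _ (hn k hk)),
    sum_Icc_eq_ite (fun k hk => hb0 _ _ (hn k hk)),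
    tsum_eq_single n fun k hk => ha0 _ _ (hn k hk)]
  refine norm_le_domP hn ?_ fun hx => by simp [ha0 _ _ hx, hb0 _ _ hx]
  unfold tailWeight
  split_ifs with hm
  · have h3 := nu_pos (n := m) (by omega)
    rw [sub_sub_cancel_left, norm_neg, norm_smul, Real.norm_of_nonneg h3.le]
    exact mul_le_mul_of_nonneg_left (hbK _ _) h3.le
  · simpa using haK (n + 1) x

/-- The weight does not involve t, so this one limit yields convergence uniformly in time. -/
theorem tendsto_eLpNorm_tailWeight (hc : IsCubeCentres c) (hK : 0 ≤ K) {p : ℝ≥0∞} (hp0 : p ≠ 0)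
    (hp : p ≠ ⊤) : Tendsto (fun m => eLpNorm (domP c (tailWeight K m)) p
      (volume.restrict unitCell)) atTop (𝓝 0) := by
  refine tendsto_eLpNorm_of_dominated hp0 hp
    (Eventually.of_forall fun m => aestronglyMeasurable_domP hc _)
    (Eventually.of_forall fun m x => ?_) (memLp_domP hc hK hp0 hp) fun x => ?_
  · obtain ⟨n, hn⟩ := exists_index hc (fractPt x)
    obtain ⟨h1, h2⟩ := tailWeight_le hK (n := n + 1) (by omega) m
    refine norm_le_domP hn ?_ fun hx => ?_
    · rw [domP, dom_eq hn]
      refine (norm_indicator_le_norm_self _ _).trans ?_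
      rwa [Real.norm_of_nonneg h1]
    · rw [domP, dom_eq hn, indicator_of_notMem hx]
  · obtain ⟨n, hn⟩ := exists_index hc (fractPt x)
    simp only [domP, dom_eq hn]
    by_cases hx : fractPt x ∈ cube c (n + 1)
    · simp only [indicator_of_mem hx]
      exact tendsto_tailWeight K (n + 1)
    · simp only [indicator_of_notMem hx]
      exact tendsto_const_nhds

end PointwiseBounds

end Assembly

end ForcedNS

theorem mainTheorem8 (W : ForcedNS.QuasiSelfSimilarVelocity)
    (η : ℝ → ℝ) (hη : ForcedNS.IsTimeReparam η)
    (c : ℕ → ForcedNS.Plane) (hc : ForcedNS.IsCubeCentres c) :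
    (∀ p : ℝ≥0∞, 1 ≤ p → p < ⊤ → ∃ C : ℝ≥0, ∀ m : ℕ, 1 ≤ m →
      ForcedNS.MemCW1p p (ForcedNS.force W η c m) ∧
      ForcedNS.cW1pNorm p (ForcedNS.force W η c m) ≤ C) ∧
    ∃ g : ForcedNS.Plane → ℝ → ForcedNS.Plane,
      ForcedNS.IsEulerForce (ForcedNS.limitVel W η c) g ∧
      ∀ p : ℝ≥0∞, 1 ≤ p → p < ⊤ →
        ForcedNS.MemCW1p p g ∧
        Tendsto (fun m => ForcedNS.cW1pNorm p fun x t => ForcedNS.force W η c m x t - g x t)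
          atTop (𝓝 0) := by
  open ForcedNS in
  obtain ⟨K, hK, hb⟩ := exists_piece_bound hη W c
  have hK2 : 0 ≤ 2 * K := by positivity
  have fbd : ∀ m, ∀ t ∈ Icc (0 : ℝ) 1, ∀ x,
      ‖force W η c m x t‖ ≤ domP c (fun n => 2 * K * n ^ 6) x := fun m t ht x => by
    rw [force_eq hη hc m x ht]
    exact norm_sum_sub_le (a := fun n x => eulerPiece W η c n x t)
      (b := fun n x => lapPiece W η c n x t) hc hK (fun n x hx => eulerPiece_eq_zero hη hx ht)
      (fun n x hx => lapPiece_eq_zero hη hx ht) (fun n x => (hb n x t ht).2.2.1)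
      (fun n x => (hb n x t ht).2.2.2.2.1) m x
  have fgbd : ∀ m, ∀ t ∈ Icc (0 : ℝ) 1, ∀ x,
      ‖gradForce W η c m x t‖ ≤ domP c (fun n => 2 * K * n ^ 6) x := fun m t ht x =>
    norm_sum_sub_le (a := fun n x => gradEulerPiece W η c n x t)
      (b := fun n x => gradLapPiece W η c n x t) hc hK
      (fun n x hx => gradEulerPiece_eq_zero hη hx ht)
      (fun n x hx => gradLapPiece_eq_zero hη hx ht) (fun n x => (hb n x t ht).2.2.2.1)
      (fun n x => (hb n x t ht).2.2.2.2.2) m x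
  refine ⟨fun p hp1 hp => ?_, limitForce W η c, isEulerForce_limitForce hη hc,
    fun p hp1 hp => ?_⟩
  · have hp0 : p ≠ 0 := (zero_lt_one.trans_le hp1).ne'
    have hM := memLp_domP hc hK2 hp0 hp.ne
    -- The majorant does not depend on m, and the factor 2 counts the field and its gradient. The
    -- quantity is finite, so `toNNReal` loses nothing.
    refine ⟨(2 * eLpNorm (domP c fun n => 2 * K * n ^ 6) p (volume.restrict unitCell)).toNNReal,
      fun m _ => ⟨?_, ?_⟩⟩
    · exact memCW1p_of_bound hp0 hp.ne (fun t ht => isPeriodic_force hη hc m ht)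
        (fun t ht => isWeakGradient_force hη hc m ht) (fbd m) (fgbd m)
        (continuousOn_force hη hc m) (continuousOn_gradForce hη m) hM
    · rw [ENNReal.coe_toNNReal (ENNReal.mul_lt_top (by simp) hM.2).ne]
      exact cW1pNorm_le_of_bound (fun t ht => isWeakGradient_force hη hc m ht) (fbd m) (fgbd m)
  · have hp0 : p ≠ 0 := (zero_lt_one.trans_le hp1).ne'
    have hM := memLp_domP hc hK2 hp0 hp.ne
    refine ⟨?_, ?_⟩
    · refine memCW1p_of_bound hp0 hp.ne (fun t _ => isPeriodic_limitForce t)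
        (fun t ht => isWeakGradient_limitForce hη hc ht) (fun t ht => ?_) (fun t ht => ?_)
        (continuousOn_limitForce hη hc) (continuousOn_gradLimitForce hη hc) hM
      · exact norm_tsum_le hc hK (fun n x hx => eulerPiece_eq_zero hη hx ht)
          (fun n x => (hb n x t ht).2.2.1)
      · exact norm_tsum_le hc hK (fun n x hx => gradEulerPiece_eq_zero hη hx ht)
          (fun n x => (hb n x t ht).2.2.2.1)
    · have h := ENNReal.Tendsto.const_mul (a := 2) (tendsto_eLpNorm_tailWeight hc hK hp0 hp.ne)
        (Or.inr (by simp))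
      rw [mul_zero] at h
      refine tendsto_of_tendsto_of_tendsto_of_le_of_le tendsto_const_nhds h (fun _ => zero_le)
        fun m => ?_
      refine cW1pNorm_le_of_bound (fun t ht => (isWeakGradient_force hη hc m ht).sub
        (isWeakGradient_limitForce hη hc ht)) (fun t ht x => ?_) (fun t ht x => ?_)
      · rw [force_eq hη hc m x ht]
        exact norm_sum_sub_tsum_le (a := fun n x => eulerPiece W η c n x t)
          (b := fun n x => lapPiece W η c n x t) hc (fun n x hx => eulerPiece_eq_zero hη hx ht)
          (fun n x hx => lapPiece_eq_zero hη hx ht) (fun n x => (hb n x t ht).2.2.1)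
          (fun n x => (hb n x t ht).2.2.2.2.1) m x
      · exact norm_sum_sub_tsum_le (a := fun n x => gradEulerPiece W η c n x t)
          (b := fun n x => gradLapPiece W η c n x t) hc
          (fun n x hx => gradEulerPiece_eq_zero hη hx ht)
          (fun n x hx => gradLapPiece_eq_zero hη hx ht) (fun n x => (hb n x t ht).2.2.2.1)
          (fun n x => (hb n x t ht).2.2.2.2.2) m x
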